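/- **Setting.** Let $n\ge 1$, $T\in(0,\infty)$, let $\mathcal O\subset\mathbb R^n$ be open and $Q=[0,T]\times\mathcal O$. Let $(\Omega,\mathcal F,\mathbb P)$ be a complete probability space carrying an $m$-dimensional standard Brownian motion, and let $(\mathcal F_t)_{t\ge0}$ be its natural filtration augmented by the $\mathbb P$-null sets. For an interval $[t_1,t_2]\subset[0,T]$, an open set $D\subset\mathcal O$, $Q'=[t_1,t_2)\times D$ or $[t_1,t_2]\times D$, and a (scalar or vector valued) random field $w(\omega,t,x)$ put $$\|w\|_{2;Q'}^2=\operatorname*{ess\,sup}_{\omega}\sup_{s\in[t_1,t_2]}E\Big[\int_s^{t_2}\|w(\tau,\cdot)\|_{L^2(D)}^2d\tau\,\Big|\,\mathcal F_s\Big],\qquad \|w\|_{\infty,2;Q'}=\operatorname*{ess\,sup}_{(\omega,s)\in\Omega\times[t_1,t_2]}\|w(\omega,s,\cdot)\|_{L^2(D)},$$ $$|\{w>0\}|_{\infty;Q'}=\operatorname*{ess\,sup}_{\omega}\sup_{s\in[t_1,t_2]}E\Big[\big|([s,t_2]\times D)\cap\{w>0\}\big|\,\Big|\,\mathcal F_s\Big],\qquad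 \|w\|_{\mathcal V_2(Q')}^2=\|w\|_{\infty,2;Q'}^2+\|\nabla w\|_{2;Q'}^2 ,$$ where $\nabla$ is the weak gradient in $x$. The space $\mathcal V_{2,0}(Q)$ consists of the predictable $W^{1,2}(\mathcal O)$-valued random fields $u$ on $Q$, square integrable together with $\nabla u$ over $\Omega\times Q$, with $\|u\|_{\mathcal V_2(Q)}<\infty$ and such that, almost surely, $t\mapsto u(t,\cdot)\in L^2(\mathcal O)$ is continuous on $[0,T]$. Write $r^+=\max(r,0)$, $r^-=\max(-r,0)$. **Cut-off functions.** A cut-off function on a half-open cylinder $Q'=[t_1,t_2)\times B_\rho(x_0)$ is a function $\zeta$ on $Q'$ with $0\le\zeta\le1$ which is a limit of functions in $C_c^\infty(Q')$ (smooth, with compact support in $Q'$; they need not vanish at the initial time $t_1$) in the norm $\big(\int_{Q'}|\zeta|^2+|\partial_t\zeta|^2+|\nabla\zeta|^2+|\nabla^2\zeta|^2\,dx\,dt\big)^{1/2}$, with $\nabla\zeta,\partial_t\zeta\in L^\infty(Q')$, and for which there are relatively open connected sets $\emptyset\ne Q'''\Subset Q''\Subset Q'$ (compact inclusions) with $\zeta=1$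 on $Q'''$ and $\zeta=0$ on $Q'\setminus Q''$. **The class.** Let $a_0\ge0$, $\mu>n+2$, $\gamma\ge0$. A field $u\in\mathcal V_{2,0}(Q)$ belongs to $BSPDG^{\pm}(a_0,\mu,\gamma;Q)$ (for the respective sign) if for all $k\in\mathbb R$, all cylinders $Q_{\rho,\tau}=[t_0-\tau,t_0)\times B_\rho(x_0)\subset Q$ with $\rho,\tau\in(0,1)$ and all cut-off functions $\zeta$ on $Q_{\rho,\tau}$, $$\|\zeta(u-k)^\pm\|_{\mathcal V_2(Q_{\rho,\tau})}^2\le\gamma\Big\{\|(u-k)^\pm\|_{2;Q_{\rho,\tau}}^2\big(1+\|\nabla\zeta\|_{L^\infty(Q_{\rho,\tau})}^2+\|\partial_t\zeta\|_{L^\infty(Q_{\rho,\tau})}\big)+(k^2+a_0^2)\,|\{(u-k)^\pm>0\}|_{\infty;Q_{\rho,\tau}}^{1-\frac2\mu}\Big\}.$$ **Theorem 5.8.** There is a constant $C>0$ depending only on $a_0,\mu,\gamma$ and $n$ such that, if $u\in BSPDG^\pm(a_0,\mu,\gamma;Q)$, then for every cylinder $Q_\rho=[t_0,t_0+\rho^2)\times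 B_\rho(x_0)\subset Q$ with $\rho\in(0,1)$, and with $Q_{\rho/2}=[t_0,t_0+\rho^2/4)\times B_{\rho/2}(x_0)$, $$\operatorname*{ess\,sup}_{\Omega\times Q_{\rho/2}}u^\pm\le C\Big\{\rho^{-\frac{n+2}2}\|u^\pm\|_{2;Q_\rho}+a_0\,\rho^{1-\frac{n+2}\mu}\Big\}$$ (for the respective sign). -/

import Mathlib

open MeasureTheory ProbabilityTheory Set Filter Topology
open scoped NNReal ENNReal

noncomputable section

namespace BSPDG

/-- `W = (W¹, …, Wᵐ)` is an `m`-dimensional standard Brownian motion on `(Ω, P)` and `𝓕` is its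
natural filtration, augmented by all the `P`-null sets. -/
structure IsBrownianSetup {Ω : Type*} {mΩ : MeasurableSpace Ω} {m : ℕ} (P : Measure Ω)
    (W : Fin m → ℝ≥0 → Ω → ℝ) (𝓕 : Filtration ℝ≥0 mΩ) : Prop where
  brownian : ∀ r, IsBrownianReal (W r) P
  indep : iIndepFun (fun (r : Fin m) (ω : Ω) (t : ℝ≥0) => W r t ω) P
  filtration_eq : ∀ t : ℝ≥0, 𝓕 t =
    (⨆ (r : Fin m) (s : ℝ≥0) (_ : s ≤ t), MeasurableSpace.comap (W r s) inferInstance) ⊔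
      MeasurableSpace.generateFrom {A : Set Ω | P A = 0}

section Fields

variable {n : ℕ} {Ω : Type*} {mΩ : MeasurableSpace Ω}

/-- The random field `w(ω, t, x)`, considered for `t ∈ [t₁, t₂]` and `x ∈ D`, is measurable with
respect to (predictable σ-algebra) ⊗ (Borel σ-algebra of `D`). Used with `0 ≤ t₁` and `D` open, so
that `[t₁, t₂] × Ω × D` is itself a measurable set and extension by zero changes nothing. -/
def IsPredictableField {F : Type*} [Zero F] [MeasurableSpace F]
    (𝓕 : Filtration ℝ≥0 mΩ) (t₁ t₂ : ℝ) (D : Set (EuclideanSpace ℝ (Fin n)))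
    (w : Ω → ℝ → EuclideanSpace ℝ (Fin n) → F) : Prop :=
  @Measurable ((ℝ≥0 × Ω) × EuclideanSpace ℝ (Fin n)) F
    (@Prod.instMeasurableSpace _ _ 𝓕.predictable inferInstance) inferInstance
    (indicator {p | (p.1.1 : ℝ) ∈ Icc t₁ t₂ ∧ p.2 ∈ D} (fun p => w p.1.2 (p.1.1 : ℝ) p.2))

/-- `w ∈ W^{1,2}(D)` with weak gradient `G`. -/
structure HasW12Gradient (D : Set (EuclideanSpace ℝ (Fin n)))
    (w : EuclideanSpace ℝ (Fin n) → ℝ)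
    (G : EuclideanSpace ℝ (Fin n) → EuclideanSpace ℝ (Fin n)) : Prop where
  memLp : MemLp w 2 (volume.restrict D)
  memLp_grad : MemLp G 2 (volume.restrict D)
  weak : ∀ φ : EuclideanSpace ℝ (Fin n) → ℝ, ContDiff ℝ ((⊤ : ℕ∞) : WithTop ℕ∞) φ →
    HasCompactSupport φ → tsupport φ ⊆ D → ∀ i : Fin n,
      ∫ x in D, w x * fderiv ℝ φ x (EuclideanSpace.single i 1) = - ∫ x in D, φ x * G x i

/-- The predictable random field `G` is the (spatial, weak) gradient of the random field `w` on
`[t₁, t₂] × D`: for almost every `(ω, t)` the function `w(ω, t, ·)` belongs to `W^{1,2}(D)` and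
`G(ω, t, ·)` is its weak gradient. -/
structure IsRandomGradient (P : Measure Ω) (𝓕 : Filtration ℝ≥0 mΩ) (t₁ t₂ : ℝ)
    (D : Set (EuclideanSpace ℝ (Fin n))) (w : Ω → ℝ → EuclideanSpace ℝ (Fin n) → ℝ)
    (G : Ω → ℝ → EuclideanSpace ℝ (Fin n) → EuclideanSpace ℝ (Fin n)) : Prop where
  predictable : IsPredictableField 𝓕 t₁ t₂ D G
  ae_grad : ∀ᵐ p ∂(P.prod (volume.restrict (Icc t₁ t₂))),
    HasW12Gradient D (w p.1 p.2) (G p.1 p.2)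

/-- `ess sup_ω sup_{s ∈ [t₁, t₂]} E[X_s | 𝓕_s]` for a nonnegative `X`.
In a Brownian filtration, and for `X_s = ∫_s^{t₂} f(ω, τ) dτ` with `f ≥ 0` of finite expectation,
the process `s ↦ E[X_s | 𝓕_s]` is taken in its continuous version; for such a version
`ess sup_ω sup_s` and `sup_s ess sup_ω` coincide (reduce `sup_s` to a countable dense set of times),
and the latter does not depend on the choice of versions. -/
def essSupCondExp (P : Measure Ω) (𝓕 : Filtration ℝ≥0 mΩ) (t₁ t₂ : ℝ)
    (X : ℝ → Ω → ℝ≥0∞) : ℝ≥0∞ :=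
  ⨆ s ∈ Icc t₁ t₂, essSup (condLExp (𝓕 s.toNNReal) P (X s)) P

/-- The norm `‖w‖_{p; [t₁, t₂] × D}
  = (ess sup_ω sup_{s ∈ [t₁, t₂]} E[∫_s^{t₂} ‖w(τ, ·)‖_{L^p(D)}^p dτ | 𝓕_s])^{1/p}`. -/
def mNorm {F : Type*} [NormedAddCommGroup F] (p : ℝ) (P : Measure Ω) (𝓕 : Filtration ℝ≥0 mΩ)
    (t₁ t₂ : ℝ) (D : Set (EuclideanSpace ℝ (Fin n)))
    (w : Ω → ℝ → EuclideanSpace ℝ (Fin n) → F) : ℝ≥0∞ :=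
  (essSupCondExp P 𝓕 t₁ t₂
    (fun s ω => ∫⁻ τ in Icc s t₂, ∫⁻ x in D, ‖w ω τ x‖ₑ ^ p)) ^ (1 / p)

/-- `|{w > 0}|_{∞; [t₁, t₂] × D}
  = ess sup_ω sup_{s ∈ [t₁, t₂]} E[ |([s, t₂] × D) ∩ {w > 0}| | 𝓕_s]`. -/
def levelMeasure (P : Measure Ω) (𝓕 : Filtration ℝ≥0 mΩ) (t₁ t₂ : ℝ)
    (D : Set (EuclideanSpace ℝ (Fin n))) (w : Ω → ℝ → EuclideanSpace ℝ (Fin n) → ℝ) : ℝ≥0∞ :=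
  essSupCondExp P 𝓕 t₁ t₂ (fun s ω =>
    volume {q : ℝ × EuclideanSpace ℝ (Fin n) | q.1 ∈ Icc s t₂ ∧ q.2 ∈ D ∧ 0 < w ω q.1 q.2})

/-- `‖w‖_{∞,2; [t₁, t₂] × D} = ess sup_{(ω, s)} ‖w(ω, s, ·)‖_{L²(D)}`. -/
def lInftyL2Norm (P : Measure Ω) (t₁ t₂ : ℝ)
    (D : Set (EuclideanSpace ℝ (Fin n))) (w : Ω → ℝ → EuclideanSpace ℝ (Fin n) → ℝ) : ℝ≥0∞ :=
  essSup (fun p : Ω × ℝ => eLpNorm (w p.1 p.2) 2 (volume.restrict D))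
    (P.prod (volume.restrict (Icc t₁ t₂)))

/-- The squared norm
`‖w‖²_{𝓥₂([t₁, t₂] × D)} = ‖w‖²_{∞,2; [t₁, t₂] × D} + ‖∇w‖²_{2; [t₁, t₂] × D}`.
The gradient is unique up to null sets, so the infimum is over equal values; it is `∞` if `w` has no
weak gradient in the sense above. -/
def v2NormSq (P : Measure Ω) (𝓕 : Filtration ℝ≥0 mΩ) (t₁ t₂ : ℝ)
    (D : Set (EuclideanSpace ℝ (Fin n))) (w : Ω → ℝ → EuclideanSpace ℝ (Fin n) → ℝ) : ℝ≥0∞ :=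
  lInftyL2Norm P t₁ t₂ D w ^ 2 +
    ⨅ (G : Ω → ℝ → EuclideanSpace ℝ (Fin n) → EuclideanSpace ℝ (Fin n))
      (_ : IsRandomGradient P 𝓕 t₁ t₂ D w G), mNorm 2 P 𝓕 t₁ t₂ D G ^ 2

/-- `u ∈ 𝓥_{2,0}([0, T] × D)`: `u` is a predictable random field with values in `W^{1,2}(D)`, square
integrable together with its gradient over `Ω × [0, T] × D`, the `𝓥₂`-norm of `u` is finite, and
almost surely `t ↦ u(t, ·)` is continuous on `[0, T]` with values in `L²(D)`. -/
structure MemV20 (P : Measure Ω) (𝓕 : Filtration ℝ≥0 mΩ) (T : ℝ)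
    (D : Set (EuclideanSpace ℝ (Fin n))) (u : Ω → ℝ → EuclideanSpace ℝ (Fin n) → ℝ) : Prop where
  predictable : IsPredictableField 𝓕 0 T D u
  exists_grad : ∃ G, IsRandomGradient P 𝓕 0 T D u G ∧
    ∫⁻ ω, (∫⁻ t in Icc 0 T, ∫⁻ x in D, (‖u ω t x‖ₑ ^ 2 + ‖G ω t x‖ₑ ^ 2)) ∂P < ∞
  norm_lt_top : v2NormSq P 𝓕 0 T D u < ∞
  continuous : ∀ᵐ ω ∂P, ∀ s ∈ Icc 0 T,
    Tendsto (fun r => eLpNorm (fun x => u ω r x - u ω s x) 2 (volume.restrict D))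
      (𝓝[Icc 0 T] s) (𝓝 0)

end Fields

section Cutoff

variable {n : ℕ}

/-- `V` is a domain of `Q'`: a connected, relatively open subset of `Q'`. (Here `Q'` is a cylinder
`[t₁, t₂) × B`, which contains its initial time.) -/
def IsDomainOf (V Q' : Set (ℝ × EuclideanSpace ℝ (Fin n))) : Prop :=
  (∃ U, IsOpen U ∧ V = U ∩ Q') ∧ IsPreconnected V

/-- `ζ` is a cut-off function on the half-open cylinder `Q' = [t₁, t₂) × B_ρ(x₀)`, with weak time
derivative `ζt` and weak spatial gradient `ζx`.
* `approx`: `ζ` is a limit of functions in `C_c^∞(Q')` for the `W^{2,2}_1(Q')`-norm (`L²`-norms of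
  the function, its time derivative, its spatial gradient and its spatial Hessian), and `ζt`, `ζx`
  are the corresponding limits (the Hessian is written entrywise, `ζxx i j = ∂ⱼ∂ᵢζ`).
  The functions in `C_c^∞(Q')` are the smooth functions on `Q'` with compact support in `Q'`, i.e. the restrictions to `Q'` of smooth functions with compact
  support in `(-∞, t₂) × B_ρ(x₀)`: they vanish near the terminal time `t₂` and the lateral
  boundary, but not necessarily at the initial time `t₁ ∈ [t₁, t₂)`.
* `exists_domains`: `ζ = 1` on a nonempty domain `Q₃ ⋐ Q₂` and `ζ = 0` off a domain `Q₂ ⋐ Q'`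
  (`Q'` is bounded, so that closures are compact). -/
structure IsCutoff (t₁ t₂ : ℝ) (x₀ : EuclideanSpace ℝ (Fin n)) (ρ : ℝ)
    (ζ ζt : ℝ × EuclideanSpace ℝ (Fin n) → ℝ)
    (ζx : ℝ × EuclideanSpace ℝ (Fin n) → EuclideanSpace ℝ (Fin n)) : Prop where
  approx : ∃ (φ : ℕ → ℝ × EuclideanSpace ℝ (Fin n) → ℝ)
      (ζxx : Fin n → Fin n → ℝ × EuclideanSpace ℝ (Fin n) → ℝ),
    (∀ l, ContDiff ℝ ((⊤ : ℕ∞) : WithTop ℕ∞) (φ l) ∧ HasCompactSupport (φ l) ∧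
      tsupport (φ l) ⊆ Iio t₂ ×ˢ Metric.ball x₀ ρ) ∧
    Tendsto (fun l => eLpNorm (fun q => φ l q - ζ q) 2
      (volume.restrict (Ico t₁ t₂ ×ˢ Metric.ball x₀ ρ))) atTop (𝓝 0) ∧
    Tendsto (fun l => eLpNorm (fun q => deriv (fun t => φ l (t, q.2)) q.1 - ζt q) 2
      (volume.restrict (Ico t₁ t₂ ×ˢ Metric.ball x₀ ρ))) atTop (𝓝 0) ∧
    Tendsto (fun l => eLpNorm (fun q => gradient (fun x => φ l (q.1, x)) q.2 - ζx q) 2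
      (volume.restrict (Ico t₁ t₂ ×ˢ Metric.ball x₀ ρ))) atTop (𝓝 0) ∧
    (∀ i j : Fin n, Tendsto (fun l => eLpNorm
      (fun q => fderiv ℝ (fun y => fderiv ℝ (fun x => φ l (q.1, x)) y (EuclideanSpace.single i 1))
        q.2 (EuclideanSpace.single j 1) - ζxx i j q) 2
      (volume.restrict (Ico t₁ t₂ ×ˢ Metric.ball x₀ ρ))) atTop (𝓝 0))
  aestronglyMeasurable :
    AEStronglyMeasurable ζ (volume.restrict (Ico t₁ t₂ ×ˢ Metric.ball x₀ ρ))
  aestronglyMeasurable_dt :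
    AEStronglyMeasurable ζt (volume.restrict (Ico t₁ t₂ ×ˢ Metric.ball x₀ ρ))
  aestronglyMeasurable_grad :
    AEStronglyMeasurable ζx (volume.restrict (Ico t₁ t₂ ×ˢ Metric.ball x₀ ρ))
  mem_Icc : ∀ q ∈ Ico t₁ t₂ ×ˢ Metric.ball x₀ ρ, ζ q ∈ Icc (0 : ℝ) 1
  exists_domains : ∃ Q₂ Q₃ : Set (ℝ × EuclideanSpace ℝ (Fin n)),
    IsDomainOf Q₂ (Ico t₁ t₂ ×ˢ Metric.ball x₀ ρ) ∧
    closure Q₂ ⊆ Ico t₁ t₂ ×ˢ Metric.ball x₀ ρ ∧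
    IsDomainOf Q₃ (Ico t₁ t₂ ×ˢ Metric.ball x₀ ρ) ∧ Q₃.Nonempty ∧ closure Q₃ ⊆ Q₂ ∧
    (∀ q ∈ Q₃, ζ q = 1) ∧ (∀ q ∈ (Ico t₁ t₂ ×ˢ Metric.ball x₀ ρ) \ Q₂, ζ q = 0)
  grad_bounded : eLpNorm ζx ∞ (volume.restrict (Ico t₁ t₂ ×ˢ Metric.ball x₀ ρ)) < ∞
  dt_bounded : eLpNorm ζt ∞ (volume.restrict (Ico t₁ t₂ ×ˢ Metric.ball x₀ ρ)) < ∞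

end Cutoff

section Class

variable {n : ℕ} {Ω : Type*} {mΩ : MeasurableSpace Ω}

/-- The backward stochastic parabolic De Giorgi class on `Q = [0, T] × D` for the truncation `pm`,
which is either `r ↦ r⁺` or `r ↦ r⁻`: the fields `u ∈ 𝓥_{2,0}(Q)` such that for every level `k`,
every cylinder `Q_{ρ,τ} = [t₀ - τ, t₀) × B_ρ(x₀) ⊆ Q` with `ρ, τ ∈ (0, 1)` and every cut-off
function `ζ` on `Q_{ρ,τ}`, with `(·)^±` standing for `pm`,
`‖ζ (u - k)^±‖²_{𝓥₂(Q_{ρ,τ})} ≤ γ { ‖(u - k)^±‖²_{2; Q_{ρ,τ}} (1 + ‖∇ζ‖²_∞ + ‖∂ₜζ‖_∞)`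
`  + (k² + a₀²) |{(u - k)^± > 0}|_{∞; Q_{ρ,τ}}^{1 - 2/μ} }`. -/
structure IsDeGiorgi (pm : ℝ → ℝ) (P : Measure Ω) (𝓕 : Filtration ℝ≥0 mΩ) (T : ℝ)
    (D : Set (EuclideanSpace ℝ (Fin n))) (a₀ μ γ : ℝ)
    (u : Ω → ℝ → EuclideanSpace ℝ (Fin n) → ℝ) : Prop where
  memV20 : MemV20 P 𝓕 T D u
  ineq : ∀ (k t₀ τ ρ : ℝ) (x₀ : EuclideanSpace ℝ (Fin n)),
    ρ ∈ Ioo (0 : ℝ) 1 → τ ∈ Ioo (0 : ℝ) 1 →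
    Ico (t₀ - τ) t₀ ×ˢ Metric.ball x₀ ρ ⊆ Icc 0 T ×ˢ D →
    ∀ (ζ ζt : ℝ × EuclideanSpace ℝ (Fin n) → ℝ)
      (ζx : ℝ × EuclideanSpace ℝ (Fin n) → EuclideanSpace ℝ (Fin n)),
    IsCutoff (t₀ - τ) t₀ x₀ ρ ζ ζt ζx →
    v2NormSq P 𝓕 (t₀ - τ) t₀ (Metric.ball x₀ ρ)
        (fun ω t x => ζ (t, x) * pm (u ω t x - k)) ≤
      ENNReal.ofReal γ *
        (mNorm 2 P 𝓕 (t₀ - τ) t₀ (Metric.ball x₀ ρ) (fun ω t x => pm (u ω t x - k)) ^ 2 *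
            (1 + eLpNorm ζx ∞ (volume.restrict (Ico (t₀ - τ) t₀ ×ˢ Metric.ball x₀ ρ)) ^ 2 +
              eLpNorm ζt ∞ (volume.restrict (Ico (t₀ - τ) t₀ ×ˢ Metric.ball x₀ ρ))) +
          ENNReal.ofReal (k ^ 2 + a₀ ^ 2) *
            levelMeasure P 𝓕 (t₀ - τ) t₀ (Metric.ball x₀ ρ)
              (fun ω t x => pm (u ω t x - k)) ^ (1 - 2 / μ))

/-- `u ∈ BSPDG⁺(a₀, μ, γ; [0, T] × D)`. -/
def IsBSPDGPlus (P : Measure Ω) (𝓕 : Filtration ℝ≥0 mΩ) (T : ℝ)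
    (D : Set (EuclideanSpace ℝ (Fin n))) (a₀ μ γ : ℝ)
    (u : Ω → ℝ → EuclideanSpace ℝ (Fin n) → ℝ) : Prop :=
  IsDeGiorgi (fun r => r⁺) P 𝓕 T D a₀ μ γ u

/-- `u ∈ BSPDG⁻(a₀, μ, γ; [0, T] × D)`; here `r⁻ = max (-r) 0 ≥ 0`. -/
def IsBSPDGMinus (P : Measure Ω) (𝓕 : Filtration ℝ≥0 mΩ) (T : ℝ)
    (D : Set (EuclideanSpace ℝ (Fin n))) (a₀ μ γ : ℝ)
    (u : Ω → ℝ → EuclideanSpace ℝ (Fin n) → ℝ) : Prop :=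
  IsDeGiorgi (fun r => r⁻) P 𝓕 T D a₀ μ γ u

/-- `ess sup_{Ω × ([t₁, t₂) × D)} w` for a nonnegative random field `w`. -/
def essSupField (P : Measure Ω) (t₁ t₂ : ℝ) (D : Set (EuclideanSpace ℝ (Fin n)))
    (w : Ω → ℝ → EuclideanSpace ℝ (Fin n) → ℝ) : ℝ≥0∞ :=
  essSup (fun p : Ω × (ℝ × EuclideanSpace ℝ (Fin n)) => ENNReal.ofReal (w p.1 p.2.1 p.2.2))
    (P.prod (volume.restrict (Ico t₁ t₂ ×ˢ D)))

end Class

end BSPDG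

end

/-!
The proof is De Giorgi's iteration. Fix `κ > 0`, the levels `k_l = κ (1 - 2^{-l})`, and cylinders
`Q_l` with initial time `t₀`, radius `ρ_l = ρ/2 + ρ/2^{l+1}` and length `ρ_l²`. The energy is
`y_l = ‖(u - k_l)⁺‖²_{2; Q_l}`.

The essential supremum of a conditional expectation `E[X | 𝓕_s]` is at most `c` exactly when
`∫_A X ≤ c P(A)` for all `A ∈ 𝓕_s` (`essSup_condLExp_le_iff`). Hence Hölder's and Chebyshev's
inequalities, applied to the product measures `cylMeasure P A s t₂ B`, give their conditional
versions.

Energies are compared as follows. Integrating the Gagliardo-Nirenberg inequality at the exponent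
`2 + 4/n` in time, and using Hölder's inequality on the positivity set, gives
`‖w‖²_2 ≤ C ‖w‖²_{𝓥₂} |{w > 0}|_∞^{2/(n+2)}` for `w ≥ 0` vanishing near the lateral boundary
(`mNorm_sq_le_v2NormSq_mul_levelMeasure`). Applied to `w = ζ (u - k_{l+1})⁺`, with `ζ` a cut-off
between `Q_{l+1}` and `Q_l`, and combined with the defining inequality of the class and with
Chebyshev's inequality `|{u > k_{l+1}}|_∞ ≤ y_l / (k_{l+1} - k_l)²`, it bounds `y_{l+1}` by `y_l`
(`deGiorgi_step`). For `y_l = κ² ρ^{n+2} Z_l` with `Z_l ≤ 1` and `κ ≥ a₀ ρ^{1-(n+2)/μ}` the bound is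
`Z_{l+1} ≤ A 16^l Z_l^{1+ε}` with `ε = 2/(n+2) - 2/μ`, which is positive because `μ > n + 2`.
So `Z_l` decays geometrically once `Z_0 ≤ θ` (`mNorm_sq_deGiorgi_le`), that is, once
`κ ≥ θ^{-1/2} ρ^{-(n+2)/2} ‖u⁺‖_{2; Q_ρ}`; in the limit `u ≤ κ` on `Q_{ρ/2}`.

The case of `u⁻` is that of `(-u)⁺`.
-/

noncomputable section

namespace BSPDG

/-! ### The Gagliardo-Nirenberg inequality for smooth functions -/

section

/-- Cauchy-Schwarz for `D(f²) = 2 f Df`; applied before the `L¹` Sobolev inequality it gives the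
endpoint dimensions one and two. -/
theorem lintegral_fderiv_sq_le {E : Type*} [NormedAddCommGroup E] [NormedSpace ℝ E]
    [MeasurableSpace E] [BorelSpace E] (μ : Measure E) {f : E → ℝ} (hf : ContDiff ℝ 1 f) :
    ∫⁻ x, ‖fderiv ℝ (fun y => f y ^ 2) x‖ₑ ∂μ ≤
      2 * ((∫⁻ x, ‖f x‖ₑ ^ (2 : ℝ) ∂μ) ^ (1 / 2 : ℝ) *
        (∫⁻ x, ‖fderiv ℝ f x‖ₑ ^ (2 : ℝ) ∂μ) ^ (1 / 2 : ℝ)) := by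
  have h1 : ∀ x, ‖fderiv ℝ (fun y => f y ^ 2) x‖ₑ = 2 * (‖f x‖ₑ * ‖fderiv ℝ f x‖ₑ) := by
    intro x
    have hd : DifferentiableAt ℝ f x := hf.differentiable one_ne_zero x
    rw [show (fun y => f y ^ 2) = f ^ 2 from rfl, fderiv_pow _ hd]
    simp only [nsmul_eq_mul]
    have h2 : ‖(2 : ℝ)‖ₑ = 2 := by simp [← ofReal_norm]
    simp [enorm_smul, enorm_mul, mul_assoc, h2]
  simp_rw [h1]
  have hc1 : Measurable fun x => ‖f x‖ₑ := hf.continuous.enorm.measurable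
  have hc2 : Measurable fun x => ‖fderiv ℝ f x‖ₑ :=
    (hf.continuous_fderiv one_ne_zero).enorm.measurable
  rw [lintegral_const_mul _ (by fun_prop)]
  gcongr
  exact ENNReal.lintegral_mul_le_Lp_mul_Lq μ Real.HolderConjugate.two_two
    hc1.aemeasurable hc2.aemeasurable

/-- The `L¹` Sobolev inequality in dimension one, where the Sobolev exponent is infinite. -/
theorem enorm_le_lintegral_fderiv_of_dim_one {f : EuclideanSpace ℝ (Fin 1) → ℝ}
    (hf : ContDiff ℝ 1 f) (hs : HasCompactSupport f) (x : EuclideanSpace ℝ (Fin 1)) :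
    ‖f x‖ₑ ≤ ∫⁻ y, ‖fderiv ℝ f y‖ₑ := by
  let e : ℝ ≃ₗᵢ[ℝ] EuclideanSpace ℝ (Fin 1) := (OrthonormalBasis.singleton (Fin 1) ℝ).repr
  have hg : ContDiff ℝ 1 (f ∘ e) := hf.comp e.contDiff
  have hgs : HasCompactSupport (f ∘ e) := hs.comp_homeomorph e.toHomeomorph
  have h1 : ‖f x‖ₑ ≤ ∫⁻ t, ‖deriv (f ∘ e) t‖ₑ := by
    have := hgs.enorm_le_lintegral_Ici_deriv hg (e.symm x)
    simp only [Function.comp_apply, e.apply_symm_apply] at this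
    exact this.trans (setLIntegral_le_lintegral _ _)
  refine h1.trans ?_
  rw [← e.measurePreserving.lintegral_comp
    (hf.continuous_fderiv one_ne_zero).enorm.measurable]
  refine lintegral_mono fun t => ?_
  have hd : HasDerivAt (f ∘ e) (fderiv ℝ f (e t) (e 1)) t := by
    refine HasFDerivAt.comp_hasDerivAt t (hf.differentiable one_ne_zero (e t)).hasFDerivAt ?_
    have := (e.toContinuousLinearEquiv.toContinuousLinearMap.hasFDerivAt (x := t)).hasDerivAt
    exact this
  rw [hd.deriv, ← ofReal_norm, ← ofReal_norm]
  apply ENNReal.ofReal_le_ofReal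
  have := (fderiv ℝ f (e t)).le_opNorm (e 1)
  simpa using this

theorem gagliardo_nirenberg_dim_one {f : EuclideanSpace ℝ (Fin 1) → ℝ}
    (hf : ContDiff ℝ 1 f) (hs : HasCompactSupport f) :
    ∫⁻ x, ‖f x‖ₑ ^ (6 : ℝ) ≤
      4 * (∫⁻ x, ‖f x‖ₑ ^ (2 : ℝ)) ^ (2 : ℝ) * ∫⁻ x, ‖fderiv ℝ f x‖ₑ ^ (2 : ℝ) := by
  set a := ∫⁻ x, ‖f x‖ₑ ^ (2 : ℝ) with ha
  set b := ∫⁻ x, ‖fderiv ℝ f x‖ₑ ^ (2 : ℝ) with hb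
  have hsq : HasCompactSupport (fun y => f y ^ 2) :=
    hs.comp_left (g := fun r : ℝ => r ^ 2) (by simp)
  have h1 : ∀ x, ‖f x‖ₑ ^ (2 : ℝ) ≤ 2 * (a ^ (1 / 2 : ℝ) * b ^ (1 / 2 : ℝ)) := by
    intro x
    have := (enorm_le_lintegral_fderiv_of_dim_one (hf.pow 2) hsq x).trans
      (lintegral_fderiv_sq_le volume hf)
    rw [enorm_pow, ← ENNReal.rpow_natCast] at this
    exact this
  calc ∫⁻ x, ‖f x‖ₑ ^ (6 : ℝ)
      ≤ ∫⁻ x, (2 * (a ^ (1 / 2 : ℝ) * b ^ (1 / 2 : ℝ))) ^ (2 : ℝ) * ‖f x‖ₑ ^ (2 : ℝ) := by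
        refine lintegral_mono fun x => ?_
        calc ‖f x‖ₑ ^ (6 : ℝ) = (‖f x‖ₑ ^ (2 : ℝ)) ^ (2 : ℝ) * ‖f x‖ₑ ^ (2 : ℝ) := by
              rw [← ENNReal.rpow_mul, ← ENNReal.rpow_add_of_nonneg _ _ (by norm_num) (by norm_num)]
              norm_num
          _ ≤ _ := by gcongr; exact h1 x
    _ = (2 * (a ^ (1 / 2 : ℝ) * b ^ (1 / 2 : ℝ))) ^ (2 : ℝ) * a := by
        rw [lintegral_const_mul _ (hf.continuous.enorm.measurable.pow_const _)]
    _ = _ := by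
        rw [ENNReal.mul_rpow_of_nonneg _ _ (by norm_num),
          ENNReal.mul_rpow_of_nonneg _ _ (by norm_num), ← ENNReal.rpow_mul, ← ENNReal.rpow_mul]
        norm_num
        ring

/-- Ladyzhenskaya's inequality: the `L¹` Sobolev inequality for `f²`. -/
theorem gagliardo_nirenberg_dim_two {f : EuclideanSpace ℝ (Fin 2) → ℝ}
    (hf : ContDiff ℝ 1 f) (hs : HasCompactSupport f) :
    ∫⁻ x, ‖f x‖ₑ ^ (4 : ℝ) ≤
      (4 * lintegralPowLePowLIntegralFDerivConst
        (volume : Measure (EuclideanSpace ℝ (Fin 2))) 2 : ℝ≥0) *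
        (∫⁻ x, ‖f x‖ₑ ^ (2 : ℝ)) * ∫⁻ x, ‖fderiv ℝ f x‖ₑ ^ (2 : ℝ) := by
  have hsq : HasCompactSupport (fun y => f y ^ 2) :=
    hs.comp_left (g := fun r : ℝ => r ^ 2) (by simp)
  have h := lintegral_pow_le_pow_lintegral_fderiv
    (volume : Measure (EuclideanSpace ℝ (Fin 2))) (hf.pow 2) hsq (p := 2)
    (by rw [finrank_euclideanSpace_fin]; exact_mod_cast Real.HolderConjugate.two_two)
  have h4 : ∀ x, ‖f x ^ 2‖ₑ ^ (2 : ℝ) = ‖f x‖ₑ ^ (4 : ℝ) := by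
    intro x
    rw [enorm_pow, ← ENNReal.rpow_natCast, ← ENNReal.rpow_mul]; norm_num
  simp_rw [h4] at h
  refine h.trans ((mul_le_mul_right (ENNReal.rpow_le_rpow (lintegral_fderiv_sq_le volume hf)
    (by norm_num)) _).trans_eq ?_)
  rw [ENNReal.mul_rpow_of_nonneg _ _ (by norm_num),
    ENNReal.mul_rpow_of_nonneg _ _ (by norm_num), ← ENNReal.rpow_mul, ← ENNReal.rpow_mul]
  norm_num
  ring

/-- Interpolation between `L²` and the Sobolev exponent `2n / (n - 2)`. -/
theorem gagliardo_nirenberg_dim_ge_three {n : ℕ} (hn : 3 ≤ n) {f : EuclideanSpace ℝ (Fin n) → ℝ}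
    (hf : ContDiff ℝ 1 f) (hs : HasCompactSupport f) :
    ∫⁻ x, ‖f x‖ₑ ^ (2 + 4 / n : ℝ) ≤
      ((eLpNormLESNormFDerivOfEqInnerConst
        (volume : Measure (EuclideanSpace ℝ (Fin n))) 2) ^ 2 : ℝ≥0) *
        (∫⁻ x, ‖f x‖ₑ ^ (2 : ℝ)) ^ (2 / n : ℝ) * ∫⁻ x, ‖fderiv ℝ f x‖ₑ ^ (2 : ℝ) := by
  have hn' : (3 : ℝ) ≤ n := by exact_mod_cast hn
  have hn2 : (0 : ℝ) < n - 2 := by linarith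
  have hn0 : (0 : ℝ) < n := by linarith
  let q : ℝ≥0 := ⟨2 * n / (n - 2), by positivity⟩
  have hq : (q : ℝ) = 2 * n / (n - 2) := rfl
  have hq0 : q ≠ 0 := by
    intro h; have : (q : ℝ) = 0 := by rw [h]; rfl
    rw [hq] at this; have : 0 < 2 * (n : ℝ) / (n - 2) := by positivity
    linarith
  have hsob := eLpNorm_le_eLpNorm_fderiv_of_eq_inner
    (volume : Measure (EuclideanSpace ℝ (Fin n))) hf hs (p := 2) (p' := q) (by norm_num)
    (by rw [finrank_euclideanSpace_fin]; omega)
    (by rw [finrank_euclideanSpace_fin, hq]; push_cast; field_simp)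
  have hfm : Measurable fun x => ‖f x‖ₑ := hf.continuous.enorm.measurable
  have hconj : Real.HolderConjugate (n / (n - 2) : ℝ) (n / 2 : ℝ) :=
    ⟨by field_simp; ring, by positivity, by positivity⟩
  have hhol := ENNReal.lintegral_mul_le_Lp_mul_Lq (volume : Measure (EuclideanSpace ℝ (Fin n)))
    hconj (f := fun x => ‖f x‖ₑ ^ (2 : ℝ)) (g := fun x => ‖f x‖ₑ ^ (4 / n : ℝ))
    (hfm.pow_const _).aemeasurable (hfm.pow_const _).aemeasurable
  have e1 : ∀ x, ((fun x => ‖f x‖ₑ ^ (2 : ℝ)) * (fun x => ‖f x‖ₑ ^ (4 / n : ℝ))) x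
      = ‖f x‖ₑ ^ (2 + 4 / n : ℝ) := fun x => by
    rw [Pi.mul_apply, ← ENNReal.rpow_add_of_nonneg _ _ (by positivity) (by positivity)]
  have e2 : ∀ x, (‖f x‖ₑ ^ (2 : ℝ)) ^ (n / (n - 2) : ℝ) = ‖f x‖ₑ ^ (q : ℝ) := fun x => by
    rw [← ENNReal.rpow_mul, hq, mul_div_assoc]
  have e3 : ∀ x, (‖f x‖ₑ ^ (4 / n : ℝ)) ^ (n / 2 : ℝ) = ‖f x‖ₑ ^ (2 : ℝ) := fun x => by
    rw [← ENNReal.rpow_mul]; congr 1; field_simp; norm_num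
  simp_rw [e1, e2, e3] at hhol
  rw [one_div_div, one_div_div] at hhol
  have e4 : (∫⁻ x, ‖f x‖ₑ ^ (q : ℝ)) ^ ((n - 2) / n : ℝ) = eLpNorm f q volume ^ (2 : ℝ) := by
    rw [← eLpNorm_nnreal_pow_eq_lintegral hq0, ← ENNReal.rpow_mul, hq]
    congr 1; field_simp
  have e5 : ∫⁻ x, ‖fderiv ℝ f x‖ₑ ^ (2 : ℝ) = eLpNorm (fderiv ℝ f) (2 : ℝ≥0) volume ^ (2 : ℝ) := by
    have := eLpNorm_nnreal_pow_eq_lintegral (μ := volume) (f := fderiv ℝ f) (p := 2) two_ne_zero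
    simpa using this.symm
  rw [e4] at hhol
  rw [e5]
  refine hhol.trans ((mul_le_mul_left (ENNReal.rpow_le_rpow hsob (by norm_num)) _).trans_eq ?_)
  rw [ENNReal.mul_rpow_of_nonneg _ _ (by norm_num)]
  push_cast
  rw [← ENNReal.rpow_natCast]
  push_cast
  ring

/-- The Gagliardo-Nirenberg inequality at the parabolic exponent `2 + 4 / n`: the gradient enters
squared, so that the inequality can be integrated in time. -/
theorem exists_gagliardo_nirenberg {n : ℕ} (hn : 1 ≤ n) :
    ∃ C : ℝ≥0, ∀ f : EuclideanSpace ℝ (Fin n) → ℝ, ContDiff ℝ 1 f → HasCompactSupport f →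
      ∫⁻ x, ‖f x‖ₑ ^ (2 + 4 / n : ℝ) ≤
        C * (∫⁻ x, ‖f x‖ₑ ^ (2 : ℝ)) ^ (2 / n : ℝ) * ∫⁻ x, ‖fderiv ℝ f x‖ₑ ^ (2 : ℝ) := by
  obtain rfl | rfl | h3 : n = 1 ∨ n = 2 ∨ 3 ≤ n := by omega
  · refine ⟨4, fun f hf hs => ?_⟩
    have := gagliardo_nirenberg_dim_one hf hs
    norm_num at this ⊢
    exact this
  · refine ⟨4 * lintegralPowLePowLIntegralFDerivConst
      (volume : Measure (EuclideanSpace ℝ (Fin 2))) 2, fun f hf hs => ?_⟩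
    have := gagliardo_nirenberg_dim_two hf hs
    norm_num at this ⊢
    exact this
  · exact ⟨_, fun f hf hs => gagliardo_nirenberg_dim_ge_three h3 hf hs⟩

end

/-! ### The Gagliardo-Nirenberg inequality for weak gradients -/

section

/-- Convolution with a probability density does not increase the `L²` norm: Jensen's inequality
followed by Tonelli's theorem. -/
theorem lintegral_sq_conv_le {E : Type*} [NormedAddCommGroup E] [MeasurableSpace E] [BorelSpace E]
    [SecondCountableTopology E] (ν : Measure E) [SFinite ν] [ν.IsAddLeftInvariant]
    [ν.IsNegInvariant] {k h : E → ℝ≥0∞}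
    (hk : Measurable k) (hk1 : ∫⁻ x, k x ∂ν = 1) (hh : AEMeasurable h ν) :
    ∫⁻ x, (∫⁻ y, k (x - y) * h y ∂ν) ^ (2 : ℝ) ∂ν ≤ ∫⁻ y, h y ^ (2 : ℝ) ∂ν := by
  have hkx : ∀ x, ∫⁻ y, k (x - y) ∂ν = 1 := fun x => by
    rw [lintegral_sub_left_eq_self k x, hk1]
  have hky : ∀ y, ∫⁻ x, k (x - y) ∂ν = 1 := fun y => by
    rw [lintegral_sub_right_eq_self k y, hk1]
  have hjensen : ∀ x, (∫⁻ y, k (x - y) * h y ∂ν) ^ (2 : ℝ) ≤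
      ∫⁻ y, k (x - y) * h y ^ (2 : ℝ) ∂ν := by
    intro x
    have hkm : Measurable fun y => k (x - y) := hk.comp (measurable_const.sub measurable_id)
    have hol := ENNReal.lintegral_mul_le_Lp_mul_Lq ν Real.HolderConjugate.two_two
      (f := fun y => k (x - y) ^ (1 / 2 : ℝ)) (g := fun y => k (x - y) ^ (1 / 2 : ℝ) * h y)
      (hkm.pow_const _).aemeasurable ((hkm.pow_const _).aemeasurable.mul hh)
    have e1 : ∀ y, ((fun y => k (x - y) ^ (1 / 2 : ℝ)) *
        (fun y => k (x - y) ^ (1 / 2 : ℝ) * h y)) y = k (x - y) * h y := fun y => by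
      rw [Pi.mul_apply, ← mul_assoc, ← ENNReal.rpow_add_of_nonneg _ _ (by norm_num) (by norm_num)]
      norm_num
    have e2 : ∀ y, (k (x - y) ^ (1 / 2 : ℝ)) ^ (2 : ℝ) = k (x - y) := fun y => by
      rw [← ENNReal.rpow_mul]; norm_num
    simp_rw [e1, ENNReal.mul_rpow_of_nonneg _ _ (zero_le_two (α := ℝ)), e2, hkx,
      ENNReal.one_rpow, one_mul] at hol
    calc _ ≤ ((∫⁻ y, k (x - y) * h y ^ (2 : ℝ) ∂ν) ^ (1 / 2 : ℝ)) ^ (2 : ℝ) := by gcongr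
      _ = _ := by rw [← ENNReal.rpow_mul]; norm_num
  calc _ ≤ ∫⁻ x, ∫⁻ y, k (x - y) * h y ^ (2 : ℝ) ∂ν ∂ν := lintegral_mono hjensen
    _ = ∫⁻ y, ∫⁻ x, k (x - y) * h y ^ (2 : ℝ) ∂ν ∂ν := by
        refine lintegral_lintegral_swap ?_
        exact (hk.comp (measurable_fst.sub measurable_snd)).aemeasurable.mul
          (hh.comp_snd.pow_const _)
    _ = _ := by
        refine lintegral_congr fun y => ?_
        have hm : Measurable fun x => k (x - y) := hk.comp (measurable_sub_const y)
        rw [lintegral_mul_const _ hm, hky, one_mul]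

variable {n : ℕ}

theorem enorm_le_sum_enorm_single (A : (EuclideanSpace ℝ (Fin n)) →L[ℝ] ℝ) :
    ‖A‖ₑ ≤ ∑ i, ‖A (EuclideanSpace.single i 1)‖ₑ := by
  have h : ‖A‖ ≤ ∑ i, ‖A (EuclideanSpace.single i 1)‖ := by
    refine A.opNorm_le_bound (by positivity) fun v => ?_
    have hv : v = ∑ i, v i • EuclideanSpace.single i (1 : ℝ) := by
      ext j; simp [Finset.sum_apply, Pi.single_apply]
    conv_lhs => rw [hv]
    rw [map_sum, Finset.sum_mul]
    refine (norm_sum_le _ _).trans (Finset.sum_le_sum fun i _ => ?_)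
    rw [map_smul, norm_smul, mul_comm]
    gcongr
    exact PiLp.norm_apply_le v i
  rw [← ofReal_norm]
  refine (ENNReal.ofReal_le_ofReal h).trans ?_
  rw [ENNReal.ofReal_sum_of_nonneg (fun _ _ => norm_nonneg _)]
  exact Finset.sum_le_sum fun i _ => (ofReal_norm _).le

theorem lintegral_ball_enorm_rpow_eq {F : Type*} [NormedAddCommGroup F]
    (B : Set (EuclideanSpace ℝ (Fin n))) (hB : MeasurableSet B)
    (w : EuclideanSpace ℝ (Fin n) → F) {p : ℝ} (hp : 0 < p) :
    ∫⁻ x, ‖B.indicator w x‖ₑ ^ p = ∫⁻ x in B, ‖w x‖ₑ ^ p := by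
  rw [← lintegral_indicator hB]
  refine lintegral_congr fun x => ?_
  by_cases hx : x ∈ B <;> simp [hx, hp]

/-- If `w` vanishes near the boundary of the ball, the gradient of its mollification is dominated
pointwise by the mollification of its weak gradient, with no product rule for weak derivatives:
either the translated kernel is an admissible test function or the mollification vanishes nearby. -/
theorem enorm_fderiv_mollify_le {x₀ : EuclideanSpace ℝ (Fin n)} {ρ r : ℝ}
    {w : EuclideanSpace ℝ (Fin n) → ℝ} {G : EuclideanSpace ℝ (Fin n) → EuclideanSpace ℝ (Fin n)}
    (hw : HasW12Gradient (Metric.ball x₀ ρ) w G)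
    (hsupp : ∀ x ∈ Metric.ball x₀ ρ, x ∉ Metric.closedBall x₀ r → w x = 0)
    (φ : ContDiffBump (0 : EuclideanSpace ℝ (Fin n))) (hφ : r + 2 * φ.rOut < ρ)
    (x : EuclideanSpace ℝ (Fin n)) :
    ‖fderiv ℝ (convolution (φ.normed volume) ((Metric.ball x₀ ρ).indicator w)
      (ContinuousLinearMap.lsmul ℝ ℝ) volume) x‖ₑ ≤
      n * ∫⁻ y, ‖φ.normed volume (x - y)‖ₑ * ‖(Metric.ball x₀ ρ).indicator G y‖ₑ := by
  set B := Metric.ball x₀ ρ with hBdef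
  have hB : MeasurableSet B := Metric.isOpen_ball.measurableSet
  set g := B.indicator w
  set ψ := φ.normed volume with hψ
  have hgL : MemLp g 2 volume := (memLp_indicator_iff_restrict hB).2 hw.memLp
  have hgI : LocallyIntegrable g volume := hgL.locallyIntegrable (by norm_num)
  have hψs : ContDiff ℝ 1 ψ := φ.contDiff_normed
  have hψc : HasCompactSupport ψ := φ.hasCompactSupport_normed
  have hder := hψc.hasFDerivAt_convolution_left (μ := volume)
    (ContinuousLinearMap.lsmul ℝ ℝ) hψs hgI x
  by_cases hx : x ∈ Metric.closedBall x₀ (r + φ.rOut)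
  · -- the kernel `y ↦ ψ (x - y)` is an admissible test function in the ball
    have htest : ∀ i, fderiv ℝ (convolution ψ g (ContinuousLinearMap.lsmul ℝ ℝ) volume) x
        (EuclideanSpace.single i 1) = ∫ y in B, ψ (x - y) * G y i := by
      intro i
      have hexist : Integrable (fun t => (ContinuousLinearMap.precompL (EuclideanSpace ℝ (Fin n))
          (ContinuousLinearMap.lsmul ℝ ℝ : ℝ →L[ℝ] ℝ →L[ℝ] ℝ)) (fderiv ℝ ψ (x - t)) (g t)) := by
        have := (hψc.fderiv ℝ).convolutionExists_left
          (ContinuousLinearMap.precompL (EuclideanSpace ℝ (Fin n))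
          (ContinuousLinearMap.lsmul ℝ ℝ : ℝ →L[ℝ] ℝ →L[ℝ] ℝ))
          (hψs.continuous_fderiv one_ne_zero) hgI x
        exact this.integrable_swap
      rw [hder.fderiv, convolution_eq_swap, ContinuousLinearMap.integral_apply hexist]
      have hweak := hw.weak (fun y => ψ (x - y))
        (φ.contDiff_normed.comp (contDiff_const.sub contDiff_id))
        (hψc.comp_homeomorph (Homeomorph.subLeft x)) ?_ i
      · have hfd : ∀ y, fderiv ℝ (fun y => ψ (x - y)) y (EuclideanSpace.single i 1)
            = - fderiv ℝ ψ (x - y) (EuclideanSpace.single i 1) := fun y => by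
          have h1 : HasFDerivAt (fun y => ψ (x - y))
              ((fderiv ℝ ψ (x - y)).comp (-ContinuousLinearMap.id ℝ _)) y :=
            (hψs.differentiable one_ne_zero (x - y)).hasFDerivAt.comp y
              ((hasFDerivAt_id y).const_sub x)
          rw [h1.fderiv]; simp
        simp_rw [hfd, mul_neg] at hweak
        rw [integral_neg, neg_inj] at hweak
        rw [← hweak, ← integral_indicator hB]
        refine integral_congr_ae (.of_forall fun y => ?_)
        by_cases hy : y ∈ B <;> simp [g, hy, mul_comm]
      · refine (closure_minimal ?_ Metric.isClosed_closedBall :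
          tsupport _ ⊆ Metric.closedBall x φ.rOut).trans ?_
        · intro y hy
          have : x - y ∈ Function.support ψ := hy
          rw [hψ, φ.support_normed_eq, mem_ball_zero_iff, ← dist_eq_norm] at this
          rw [Metric.mem_closedBall, dist_comm]
          exact this.le
        · exact Metric.closedBall_subset_ball' (by
            have := Metric.mem_closedBall.1 hx
            linarith)
    refine (enorm_le_sum_enorm_single _).trans ?_
    calc _ ≤ ∑ i : Fin n, ∫⁻ y, ‖ψ (x - y)‖ₑ * ‖B.indicator G y‖ₑ := by
          refine Finset.sum_le_sum fun i _ => ?_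
          rw [htest]
          refine (enorm_integral_le_lintegral_enorm _).trans ?_
          rw [← lintegral_indicator hB]
          refine lintegral_mono fun y => ?_
          by_cases hy : y ∈ B
          · simp only [hy, indicator_of_mem, enorm_mul]
            gcongr
            rw [← ofReal_norm, ← ofReal_norm]
            exact ENNReal.ofReal_le_ofReal (PiLp.norm_apply_le _ _)
          · simp [hy]
      _ = _ := by simp
  · -- near such `x` the mollification vanishes identically
    have hzero : (convolution ψ g (ContinuousLinearMap.lsmul ℝ ℝ) volume) =ᶠ[𝓝 x] fun _ => 0 := by
      filter_upwards [Metric.isClosed_closedBall.isOpen_compl.mem_nhds hx] with z hz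
      rw [convolution_eq_swap]
      refine integral_eq_zero_of_ae (.of_forall fun y => ?_)
      simp only [ContinuousLinearMap.lsmul_apply, smul_eq_mul, Pi.zero_apply, mul_eq_zero]
      by_contra! hne
      have h1 : z - y ∈ Function.support ψ := hne.1
      rw [hψ, φ.support_normed_eq, mem_ball_zero_iff, ← dist_eq_norm] at h1
      have hyB : y ∈ B := mem_of_indicator_ne_zero hne.2
      have hwy : w y ≠ 0 := by simpa [g, hyB] using hne.2
      have h2 : y ∈ Metric.closedBall x₀ r := by
        by_contra h; exact hwy (hsupp y hyB h)
      apply hz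
      rw [Metric.mem_closedBall] at h2 ⊢
      linarith [dist_triangle z y x₀]
    rw [hzero.fderiv_eq, fderiv_fun_const, Pi.zero_apply, ← ofReal_norm, norm_zero,
      ENNReal.ofReal_zero]
    exact zero_le

/-- The Gagliardo-Nirenberg inequality passes from smooth functions to Sobolev functions vanishing
near the sphere: mollify, and conclude by almost everywhere convergence and Fatou's lemma. -/
theorem gagliardo_nirenberg_of_hasW12Gradient {C : ℝ≥0}
    (hC : ∀ f : EuclideanSpace ℝ (Fin n) → ℝ, ContDiff ℝ 1 f → HasCompactSupport f →
      ∫⁻ x, ‖f x‖ₑ ^ (2 + 4 / n : ℝ) ≤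
        C * (∫⁻ x, ‖f x‖ₑ ^ (2 : ℝ)) ^ (2 / n : ℝ) * ∫⁻ x, ‖fderiv ℝ f x‖ₑ ^ (2 : ℝ))
    {x₀ : EuclideanSpace ℝ (Fin n)} {ρ r : ℝ} (hr : r < ρ)
    {w : EuclideanSpace ℝ (Fin n) → ℝ} {G : EuclideanSpace ℝ (Fin n) → EuclideanSpace ℝ (Fin n)}
    (hw : HasW12Gradient (Metric.ball x₀ ρ) w G)
    (hsupp : ∀ x ∈ Metric.ball x₀ ρ, x ∉ Metric.closedBall x₀ r → w x = 0) :
    ∫⁻ x in Metric.ball x₀ ρ, ‖w x‖ₑ ^ (2 + 4 / n : ℝ) ≤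
      (C * n ^ 2 : ℝ≥0) * (∫⁻ x in Metric.ball x₀ ρ, ‖w x‖ₑ ^ (2 : ℝ)) ^ (2 / n : ℝ) *
        ∫⁻ x in Metric.ball x₀ ρ, ‖G x‖ₑ ^ (2 : ℝ) := by
  set B := Metric.ball x₀ ρ with hBdef
  have hB : MeasurableSet B := Metric.isOpen_ball.measurableSet
  rw [← lintegral_ball_enorm_rpow_eq B hB w two_pos,
    ← lintegral_ball_enorm_rpow_eq B hB G two_pos,
    ← lintegral_ball_enorm_rpow_eq B hB w (p := 2 + 4 / n) (by positivity)]
  set g := B.indicator w with hg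
  have hgL : MemLp g 2 volume := (memLp_indicator_iff_restrict hB).2 hw.memLp
  have hGL : MemLp (B.indicator G) 2 volume := (memLp_indicator_iff_restrict hB).2 hw.memLp_grad
  have hgI : LocallyIntegrable g volume := hgL.locallyIntegrable (by norm_num)
  have hgc : HasCompactSupport g := by
    refine HasCompactSupport.intro (isCompact_closedBall x₀ ρ) fun x hx => ?_
    have : x ∉ B := fun h => hx (Metric.ball_subset_closedBall h)
    simp [hg, this]
  let ε : ℕ → ℝ := fun j => (ρ - r) / 3 / (j + 1)
  have hε : ∀ j, 0 < ε j := fun j => by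
    have : 0 < ρ - r := by linarith
    positivity
  have hε' : ∀ j, r + 2 * ε j < ρ := fun j => by
    have h1 : ε j ≤ (ρ - r) / 3 := div_le_self (by linarith) (by linarith [j.cast_nonneg (α := ℝ)])
    linarith
  let φ : ℕ → ContDiffBump (0 : EuclideanSpace ℝ (Fin n)) := fun j =>
    ⟨ε j / 2, ε j, by linarith [hε j], by linarith [hε j]⟩
  have hlim : Tendsto (fun j => (φ j).rOut) atTop (𝓝 0) :=
    (tendsto_const_nhds (x := (ρ - r) / 3)).div_atTop
      (tendsto_atTop_add_const_right _ (1 : ℝ) tendsto_natCast_atTop_atTop)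
  have hae := ContDiffBump.ae_convolution_tendsto_right_of_locallyIntegrable
    (μ := (volume : Measure (EuclideanSpace ℝ (Fin n)))) (K := 2) hlim
    (.of_forall fun j => by simp only [φ]; linarith) hgI
  set f : ℕ → EuclideanSpace ℝ (Fin n) → ℝ := fun j =>
    convolution ((φ j).normed volume) g (ContinuousLinearMap.lsmul ℝ ℝ) volume with hf
  have hfs : ∀ j, ContDiff ℝ 1 (f j) := fun j =>
    (φ j).hasCompactSupport_normed.contDiff_convolution_left _ (φ j).contDiff_normed hgI
  have hfc : ∀ j, HasCompactSupport (f j) := fun j =>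
    HasCompactSupport.convolution _ (φ j).hasCompactSupport_normed hgc
  have hk : ∀ j, Measurable fun x => ‖(φ j).normed volume x‖ₑ := fun j =>
    (φ j).continuous_normed.enorm.measurable
  have hk1 : ∀ j, ∫⁻ x, ‖(φ j).normed volume x‖ₑ = 1 := fun j => by
    have h1 := (φ j).integral_normed (μ := volume)
    rw [← ENNReal.ofReal_one, ← h1, ofReal_integral_eq_lintegral_ofReal
      (φ j).integrable_normed (.of_forall (φ j).nonneg_normed)]
    refine lintegral_congr fun x => ?_
    rw [← ofReal_norm, Real.norm_of_nonneg ((φ j).nonneg_normed x)]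
  have hf2 : ∀ j, ∫⁻ x, ‖f j x‖ₑ ^ (2 : ℝ) ≤ ∫⁻ x, ‖g x‖ₑ ^ (2 : ℝ) := fun j => by
    refine le_trans (lintegral_mono fun x => ENNReal.rpow_le_rpow ?_ zero_le_two)
      (lintegral_sq_conv_le volume (hk j) (hk1 j) hgL.1.enorm)
    simp only [hf, convolution_eq_swap]
    refine (enorm_integral_le_lintegral_enorm _).trans (lintegral_mono fun y => ?_)
    simp [enorm_mul]
  have hd2 : ∀ j, ∫⁻ x, ‖fderiv ℝ (f j) x‖ₑ ^ (2 : ℝ) ≤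
      n ^ 2 * ∫⁻ x, ‖B.indicator G x‖ₑ ^ (2 : ℝ) := fun j => by
    calc _ ≤ ∫⁻ x, (n : ℝ≥0∞) ^ 2 * (∫⁻ y, ‖(φ j).normed volume (x - y)‖ₑ *
            ‖B.indicator G y‖ₑ) ^ (2 : ℝ) := by
          refine lintegral_mono fun x => ?_
          refine (ENNReal.rpow_le_rpow (enorm_fderiv_mollify_le hw hsupp (φ j) (hε' j) x)
            zero_le_two).trans_eq ?_
          rw [ENNReal.mul_rpow_of_nonneg _ _ zero_le_two, ← ENNReal.rpow_natCast]
          norm_num [hBdef]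
      _ = (n : ℝ≥0∞) ^ 2 * ∫⁻ x, (∫⁻ y, ‖(φ j).normed volume (x - y)‖ₑ *
            ‖B.indicator G y‖ₑ) ^ (2 : ℝ) :=
          lintegral_const_mul' _ _ (by simp)
      _ ≤ _ := by
          exact mul_le_mul_right (lintegral_sq_conv_le volume (hk j) (hk1 j) hGL.1.enorm) _
  have hbound : ∀ j, ∫⁻ x, ‖f j x‖ₑ ^ (2 + 4 / n : ℝ) ≤
      (C * n ^ 2 : ℝ≥0) * (∫⁻ x, ‖g x‖ₑ ^ (2 : ℝ)) ^ (2 / n : ℝ) *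
        ∫⁻ x, ‖B.indicator G x‖ₑ ^ (2 : ℝ) := fun j => by
    calc _ ≤ _ := hC (f j) (hfs j) (hfc j)
      _ ≤ C * (∫⁻ x, ‖g x‖ₑ ^ (2 : ℝ)) ^ (2 / n : ℝ) *
          (n ^ 2 * ∫⁻ x, ‖B.indicator G x‖ₑ ^ (2 : ℝ)) := by
        exact mul_le_mul (mul_le_mul_right (ENNReal.rpow_le_rpow (hf2 j) (by positivity)) _)
          (hd2 j) zero_le zero_le
      _ = _ := by push_cast; ring
  calc ∫⁻ x, ‖g x‖ₑ ^ (2 + 4 / n : ℝ)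
      = ∫⁻ x, liminf (fun j => ‖f j x‖ₑ ^ (2 + 4 / n : ℝ)) atTop := by
        refine lintegral_congr_ae ?_
        filter_upwards [hae] with x hx
        exact ((ENNReal.continuous_rpow_const.tendsto _).comp
          ((continuous_enorm.tendsto _).comp hx)).liminf_eq.symm
    _ ≤ liminf (fun j => ∫⁻ x, ‖f j x‖ₑ ^ (2 + 4 / n : ℝ)) atTop :=
        lintegral_liminf_le fun j => (hfs j).continuous.enorm.measurable.pow_const _
    _ ≤ _ := by
        refine (liminf_le_liminf (.of_forall hbound)).trans ?_
        simp

end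

/-! ### Conditional bounds and the parabolic embedding -/

section

/-- `X` is arbitrary here because `setLIntegral_condLExp` holds for non-measurable `X` as well. -/
theorem essSup_condLExp_le_iff {Ω : Type*} {m mΩ : MeasurableSpace Ω} {P : Measure[mΩ] Ω}
    [IsFiniteMeasure P] (hm : m ≤ mΩ) {X : Ω → ℝ≥0∞} {c : ℝ≥0∞} :
    essSup (condLExp m P X) P ≤ c ↔
      ∀ A, MeasurableSet[m] A → ∫⁻ ω in A, X ω ∂P ≤ c * P A := by
  constructor
  · intro h A hA
    rw [← setLIntegral_condLExp hm P X hA, ← setLIntegral_const]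
    refine lintegral_mono_ae (ae_restrict_of_ae ?_)
    filter_upwards [ENNReal.ae_le_essSup (μ := P) (condLExp m P X)] with ω hω
    exact hω.trans h
  · intro h
    refine essSup_le_of_ae_le c (ae_le_of_ae_le_trim (hm := hm) ?_)
    refine ae_le_of_forall_setLIntegral_le_of_sigmaFinite (μ := P.trim hm)
      (measurable_condLExp m P X) fun A hA _ => ?_
    rw [setLIntegral_condLExp_trim hm P X hA, setLIntegral_const, trim_measurableSet_eq hm hA]
    exact h A hA

variable {n : ℕ} {Ω : Type*} {mΩ : MeasurableSpace Ω} {P : Measure Ω} {𝓕 : Filtration ℝ≥0 mΩ}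
  {t₁ t₂ s : ℝ} {B : Set (EuclideanSpace ℝ (Fin n))}

theorem essSupCondExp_le_iff [IsFiniteMeasure P] {X : ℝ → Ω → ℝ≥0∞} {c : ℝ≥0∞} :
    essSupCondExp P 𝓕 t₁ t₂ X ≤ c ↔
      ∀ s ∈ Icc t₁ t₂, ∀ A, MeasurableSet[𝓕 s.toNNReal] A → ∫⁻ ω in A, X s ω ∂P ≤ c * P A := by
  simp only [essSupCondExp, iSup₂_le_iff, essSup_condLExp_le_iff (𝓕.le _)]

/-- The product measure on `A × ([s, t₂] × B)`. A bound `E[∫_s^{t₂} ∫_B f | 𝓕_s] ≤ c` says that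
the integral of `f` against this measure is at most `c * P A` for every `A ∈ 𝓕_s`, which turns
conditional inequalities into inequalities for integrals. -/
def cylMeasure (P : Measure Ω) (A : Set Ω) (s t₂ : ℝ) (B : Set (EuclideanSpace ℝ (Fin n))) :
    Measure (Ω × (ℝ × EuclideanSpace ℝ (Fin n))) :=
  (P.restrict A).prod (volume.restrict (Icc s t₂ ×ˢ B))

theorem cylMeasure_mono [SFinite P] {A A' : Set Ω} (hA : A ⊆ A') {s' t₂' : ℝ} (hs : s' ≤ s)
    (ht : t₂ ≤ t₂') {B' : Set (EuclideanSpace ℝ (Fin n))} (hB : B ⊆ B') :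
    cylMeasure P A s t₂ B ≤ cylMeasure P A' s' t₂' B' := by
  rw [cylMeasure, cylMeasure, Measure.prod_restrict, Measure.prod_restrict]
  exact Measure.restrict_mono
    (prod_mono hA (prod_mono (Icc_subset_Icc hs ht) hB)) le_rfl

theorem lintegral_cylMeasure [SFinite P] {A : Set Ω} {f : Ω → ℝ → EuclideanSpace ℝ (Fin n) → ℝ≥0∞}
    (hf : AEMeasurable (fun p : Ω × (ℝ × EuclideanSpace ℝ (Fin n)) => f p.1 p.2.1 p.2.2)
      (cylMeasure P A s t₂ B)) :
    ∫⁻ ω in A, (∫⁻ τ in Icc s t₂, ∫⁻ x in B, f ω τ x) ∂P =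
      ∫⁻ p, f p.1 p.2.1 p.2.2 ∂cylMeasure P A s t₂ B := by
  rw [cylMeasure, lintegral_prod _ hf]
  refine lintegral_congr_ae ?_
  filter_upwards [Measure.ae_ae_of_ae_prod hf.ae_eq_mk] with ω hω
  have hm : AEMeasurable (fun q : ℝ × EuclideanSpace ℝ (Fin n) => f ω q.1 q.2)
      (volume.restrict (Icc s t₂ ×ˢ B)) :=
    ⟨fun q => hf.mk _ (ω, q), hf.measurable_mk.comp measurable_prodMk_left, hω⟩
  rw [Measure.volume_eq_prod, ← Measure.prod_restrict] at hm ⊢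
  rw [lintegral_prod _ hm]

theorem lintegral_volume_levelSet [SFinite P] {A : Set Ω} (hB : MeasurableSet B)
    {w : Ω → ℝ → EuclideanSpace ℝ (Fin n) → ℝ}
    (hw : AEMeasurable (fun p : Ω × (ℝ × EuclideanSpace ℝ (Fin n)) => w p.1 p.2.1 p.2.2)
      (cylMeasure P A s t₂ B)) :
    ∫⁻ ω in A, volume {q : ℝ × EuclideanSpace ℝ (Fin n) |
        q.1 ∈ Icc s t₂ ∧ q.2 ∈ B ∧ 0 < w ω q.1 q.2} ∂P =
      cylMeasure P A s t₂ B {p | 0 < w p.1 p.2.1 p.2.2} := by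
  have hnull : NullMeasurableSet {p : Ω × (ℝ × EuclideanSpace ℝ (Fin n)) | 0 < w p.1 p.2.1 p.2.2}
      (cylMeasure P A s t₂ B) := nullMeasurableSet_lt aemeasurable_const hw
  rw [← lintegral_indicator_one₀ hnull, cylMeasure, lintegral_prod]
  · refine lintegral_congr_ae ?_
    filter_upwards [Measure.ae_ae_of_ae_prod hw.ae_eq_mk] with ω hω
    have hm : AEMeasurable (fun q : ℝ × EuclideanSpace ℝ (Fin n) => w ω q.1 q.2)
        (volume.restrict (Icc s t₂ ×ˢ B)) :=
      ⟨fun q => hw.mk _ (ω, q), hw.measurable_mk.comp measurable_prodMk_left, hω⟩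
    have hn : NullMeasurableSet {q : ℝ × EuclideanSpace ℝ (Fin n) | 0 < w ω q.1 q.2}
        (volume.restrict (Icc s t₂ ×ˢ B)) := nullMeasurableSet_lt aemeasurable_const hm
    have := lintegral_indicator_one₀ hn
    rw [Measure.restrict_apply' (measurableSet_Icc.prod hB)] at this
    have e : {q : ℝ × EuclideanSpace ℝ (Fin n) | q.1 ∈ Icc s t₂ ∧ q.2 ∈ B ∧ 0 < w ω q.1 q.2}
        = {q | 0 < w ω q.1 q.2} ∩ Icc s t₂ ×ˢ B := by
      ext q; simp only [mem_ofPred_eq, mem_inter_iff, mem_prod]; tauto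
    rw [e, ← this]
    rfl
  · exact aemeasurable_one.indicator₀ hnull

theorem mNorm_two_sq {F : Type*} [NormedAddCommGroup F]
    (w : Ω → ℝ → EuclideanSpace ℝ (Fin n) → F) :
    mNorm 2 P 𝓕 t₁ t₂ B w ^ 2 = essSupCondExp P 𝓕 t₁ t₂
      (fun s ω => ∫⁻ τ in Icc s t₂, ∫⁻ x in B, ‖w ω τ x‖ₑ ^ (2 : ℝ)) := by
  rw [mNorm, ← ENNReal.rpow_natCast, ← ENNReal.rpow_mul]
  norm_num

theorem mNorm_sq_le_iff [IsFiniteMeasure P] {w : Ω → ℝ → EuclideanSpace ℝ (Fin n) → ℝ}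
    (hw : AEMeasurable (fun p : Ω × (ℝ × EuclideanSpace ℝ (Fin n)) => w p.1 p.2.1 p.2.2)
      (cylMeasure P univ t₁ t₂ B)) {c : ℝ≥0∞} :
    mNorm 2 P 𝓕 t₁ t₂ B w ^ 2 ≤ c ↔
      ∀ s ∈ Icc t₁ t₂, ∀ A, MeasurableSet[𝓕 s.toNNReal] A →
        ∫⁻ p, ‖w p.1 p.2.1 p.2.2‖ₑ ^ (2 : ℝ) ∂cylMeasure P A s t₂ B ≤ c * P A := by
  rw [mNorm_two_sq, essSupCondExp_le_iff]
  refine forall₂_congr fun s hs => forall₂_congr fun A _ => ?_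
  have hm := (hw.enorm.pow_const (2 : ℝ)).mono_measure
    (cylMeasure_mono (subset_univ A) hs.1 le_rfl subset_rfl)
  rw [lintegral_cylMeasure (f := fun ω τ x => ‖w ω τ x‖ₑ ^ (2 : ℝ)) hm]

theorem levelMeasure_le_iff [IsFiniteMeasure P] (hB : MeasurableSet B)
    {w : Ω → ℝ → EuclideanSpace ℝ (Fin n) → ℝ}
    (hw : AEMeasurable (fun p : Ω × (ℝ × EuclideanSpace ℝ (Fin n)) => w p.1 p.2.1 p.2.2)
      (cylMeasure P univ t₁ t₂ B)) {c : ℝ≥0∞} :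
    levelMeasure P 𝓕 t₁ t₂ B w ≤ c ↔
      ∀ s ∈ Icc t₁ t₂, ∀ A, MeasurableSet[𝓕 s.toNNReal] A →
        cylMeasure P A s t₂ B {p | 0 < w p.1 p.2.1 p.2.2} ≤ c * P A := by
  rw [levelMeasure, essSupCondExp_le_iff]
  refine forall₂_congr fun s hs => forall₂_congr fun A _ => ?_
  rw [lintegral_volume_levelSet hB
    (hw.mono_measure (cylMeasure_mono (subset_univ A) hs.1 le_rfl subset_rfl))]

theorem levelMeasure_ne_top [IsFiniteMeasure P] (hBb : Bornology.IsBounded B)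
    (w : Ω → ℝ → EuclideanSpace ℝ (Fin n) → ℝ) :
    levelMeasure P 𝓕 t₁ t₂ B w ≠ ∞ := by
  have h : levelMeasure P 𝓕 t₁ t₂ B w ≤ volume (Icc t₁ t₂ ×ˢ B) := by
    rw [levelMeasure, essSupCondExp_le_iff]
    intro s hs A _
    rw [← setLIntegral_const]
    exact lintegral_mono fun ω => measure_mono fun q hq => ⟨⟨hs.1.trans hq.1.1, hq.1.2⟩, hq.2.1⟩
  refine ne_top_of_le_ne_top ?_ h
  exact ((Metric.isBounded_Icc _ _).prod hBb).measure_lt_top.ne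

/-- Integrating in time a Gagliardo-Nirenberg inequality that holds at almost every `(ω, t)`: the
`L²(B)` norm is taken out by its essential supremum, and `‖∇w‖²` is left to be integrated. -/
theorem lintegral_rpow_le_of_gradient [IsFiniteMeasure P] {K : ℝ≥0∞} (hK : K ≠ ∞) {c p : ℝ}
    (hc : 0 ≤ c) {w : Ω → ℝ → EuclideanSpace ℝ (Fin n) → ℝ}
    {G : Ω → ℝ → EuclideanSpace ℝ (Fin n) → EuclideanSpace ℝ (Fin n)}
    (hGN : ∀ᵐ q ∂(P.prod (volume.restrict (Icc t₁ t₂))),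
      ∫⁻ x in B, ‖w q.1 q.2 x‖ₑ ^ p ≤ K * (∫⁻ x in B, ‖w q.1 q.2 x‖ₑ ^ (2 : ℝ)) ^ c *
        ∫⁻ x in B, ‖G q.1 q.2 x‖ₑ ^ (2 : ℝ))
    (hw : AEMeasurable (fun p : Ω × (ℝ × EuclideanSpace ℝ (Fin n)) => w p.1 p.2.1 p.2.2)
      (cylMeasure P univ t₁ t₂ B))
    (hL : lInftyL2Norm P t₁ t₂ B w ≠ ∞)
    (hs : s ∈ Icc t₁ t₂) {A : Set Ω} (hA : MeasurableSet[𝓕 s.toNNReal] A) :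
    ∫⁻ q, ‖w q.1 q.2.1 q.2.2‖ₑ ^ p ∂cylMeasure P A s t₂ B ≤
      K * (lInftyL2Norm P t₁ t₂ B w ^ 2) ^ c * (mNorm 2 P 𝓕 t₁ t₂ B G ^ 2 * P A) := by
  have hm := (hw.enorm.pow_const p).mono_measure
    (cylMeasure_mono (subset_univ A) hs.1 le_rfl subset_rfl)
  rw [← lintegral_cylMeasure (f := fun ω τ x => ‖w ω τ x‖ₑ ^ p) hm]
  have hconst : K * (lInftyL2Norm P t₁ t₂ B w ^ 2) ^ c ≠ ∞ :=
    ENNReal.mul_ne_top hK (ENNReal.rpow_ne_top_of_nonneg hc (ENNReal.pow_ne_top hL))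
  have hae : ∀ᵐ ω ∂P, ∀ᵐ τ ∂(volume.restrict (Icc t₁ t₂)), ∫⁻ x in B, ‖w ω τ x‖ₑ ^ p ≤
      K * (lInftyL2Norm P t₁ t₂ B w ^ 2) ^ c * ∫⁻ x in B, ‖G ω τ x‖ₑ ^ (2 : ℝ) := by
    refine Measure.ae_ae_of_ae_prod (p := fun q : Ω × ℝ => ∫⁻ x in B, ‖w q.1 q.2 x‖ₑ ^ p ≤
      K * (lInftyL2Norm P t₁ t₂ B w ^ 2) ^ c * ∫⁻ x in B, ‖G q.1 q.2 x‖ₑ ^ (2 : ℝ)) ?_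
    filter_upwards [hGN, ENNReal.ae_le_essSup (μ := P.prod (volume.restrict (Icc t₁ t₂)))
      (fun q : Ω × ℝ => eLpNorm (w q.1 q.2) 2 (volume.restrict B))] with q hq hq'
    refine hq.trans ?_
    gcongr
    have := eLpNorm_nnreal_pow_eq_lintegral (μ := volume.restrict B) (f := w q.1 q.2) (p := 2)
      two_ne_zero
    simp only [NNReal.coe_ofNat, ENNReal.coe_ofNat] at this
    rw [← this, ← ENNReal.rpow_natCast]
    exact ENNReal.rpow_le_rpow hq' (by norm_num)
  calc ∫⁻ ω in A, (∫⁻ τ in Icc s t₂, ∫⁻ x in B, ‖w ω τ x‖ₑ ^ p) ∂P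
      ≤ ∫⁻ ω in A, K * (lInftyL2Norm P t₁ t₂ B w ^ 2) ^ c *
          (∫⁻ τ in Icc s t₂, ∫⁻ x in B, ‖G ω τ x‖ₑ ^ (2 : ℝ)) ∂P := by
        refine lintegral_mono_ae (ae_restrict_of_ae ?_)
        filter_upwards [hae] with ω hω
        rw [← lintegral_const_mul' _ _ hconst]
        exact lintegral_mono_ae (ae_restrict_of_ae_restrict_of_subset
          (Icc_subset_Icc_left hs.1) hω)
    _ = K * (lInftyL2Norm P t₁ t₂ B w ^ 2) ^ c *
          ∫⁻ ω in A, (∫⁻ τ in Icc s t₂, ∫⁻ x in B, ‖G ω τ x‖ₑ ^ (2 : ℝ)) ∂P :=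
        lintegral_const_mul' _ _ hconst
    _ ≤ _ := by
        gcongr
        exact essSupCondExp_le_iff.1 (mNorm_two_sq (P := P) (𝓕 := 𝓕) G).ge s hs A hA

/-- Hölder's inequality on the set where `w` is positive. -/
theorem lintegral_sq_le_rpow_mul_measure_pos {α : Type*} [MeasurableSpace α] {ν : Measure α}
    {w : α → ℝ} (hw : AEMeasurable w ν) (hw0 : ∀ x, 0 ≤ w x) (hn : 1 ≤ n) :
    ∫⁻ x, ‖w x‖ₑ ^ (2 : ℝ) ∂ν ≤ (∫⁻ x, ‖w x‖ₑ ^ (2 + 4 / n : ℝ) ∂ν) ^ (n / (n + 2) : ℝ) *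
      ν {x | 0 < w x} ^ (2 / (n + 2) : ℝ) := by
  have hn0 : (0 : ℝ) < n := by exact_mod_cast hn
  have hnull : NullMeasurableSet {x | 0 < w x} ν := nullMeasurableSet_lt aemeasurable_const hw
  have hconj : Real.HolderConjugate ((n + 2) / n : ℝ) ((n + 2) / 2 : ℝ) :=
    ⟨by field_simp, by positivity, by positivity⟩
  have hol := ENNReal.lintegral_mul_le_Lp_mul_Lq ν hconj (f := fun x => ‖w x‖ₑ ^ (2 : ℝ))
    (g := {x | 0 < w x}.indicator 1) (hw.enorm.pow_const _) (aemeasurable_one.indicator₀ hnull)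
  have e1 : ∀ x, ((fun x => ‖w x‖ₑ ^ (2 : ℝ)) *
      ({x | 0 < w x}.indicator 1 : α → ℝ≥0∞)) x =
      ‖w x‖ₑ ^ (2 : ℝ) := fun x => by
    by_cases hx : 0 < w x
    · simp [hx]
    · simp [le_antisymm (not_lt.1 hx) (hw0 x)]
  have e2 : ∀ x, (‖w x‖ₑ ^ (2 : ℝ)) ^ ((n + 2) / n : ℝ) = ‖w x‖ₑ ^ (2 + 4 / n : ℝ) := fun x => by
    rw [← ENNReal.rpow_mul]; congr 1; field_simp; ring
  have e3 : ∀ x, ({x | 0 < w x}.indicator (1 : α → ℝ≥0∞) x) ^ ((n + 2) / 2 : ℝ) =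
      {x | 0 < w x}.indicator 1 x := fun x => by
    have : (0 : ℝ) < (n + 2) / 2 := by positivity
    by_cases hx : 0 < w x <;> simp [hx, this]
  simp_rw [e1, e2, e3, lintegral_indicator_one₀ hnull, one_div_div] at hol
  exact hol

/-- The parabolic embedding: for fields vanishing near the lateral boundary, the `L²`-type norm is
controlled by the `𝓥₂` norm with a gain of the power `2 / (n + 2)` of the measure of the positivity
set. This gain makes the De Giorgi recursion superlinear. -/
theorem mNorm_sq_le_v2NormSq_mul_levelMeasure [IsFiniteMeasure P] (hn : 1 ≤ n) {C : ℝ≥0}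
    (hC : ∀ f : EuclideanSpace ℝ (Fin n) → ℝ, ContDiff ℝ 1 f → HasCompactSupport f →
      ∫⁻ x, ‖f x‖ₑ ^ (2 + 4 / n : ℝ) ≤
        C * (∫⁻ x, ‖f x‖ₑ ^ (2 : ℝ)) ^ (2 / n : ℝ) * ∫⁻ x, ‖fderiv ℝ f x‖ₑ ^ (2 : ℝ))
    {x₀ : EuclideanSpace ℝ (Fin n)} {ρ r : ℝ} (hr : r < ρ)
    {w : Ω → ℝ → EuclideanSpace ℝ (Fin n) → ℝ}
    (hw : AEMeasurable (fun p : Ω × (ℝ × EuclideanSpace ℝ (Fin n)) => w p.1 p.2.1 p.2.2)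
      (cylMeasure P univ t₁ t₂ (Metric.ball x₀ ρ)))
    (hw0 : ∀ ω t x, 0 ≤ w ω t x)
    (hsupp : ∀ ω t, ∀ x ∈ Metric.ball x₀ ρ, x ∉ Metric.closedBall x₀ r → w ω t x = 0)
    (hfin : v2NormSq P 𝓕 t₁ t₂ (Metric.ball x₀ ρ) w ≠ ∞) :
    mNorm 2 P 𝓕 t₁ t₂ (Metric.ball x₀ ρ) w ^ 2 ≤
      (((C * n ^ 2 : ℝ≥0) : ℝ≥0∞) ^ (n / (n + 2) : ℝ) *
        levelMeasure P 𝓕 t₁ t₂ (Metric.ball x₀ ρ) w ^ (2 / (n + 2) : ℝ)) *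
      v2NormSq P 𝓕 t₁ t₂ (Metric.ball x₀ ρ) w := by
  have hn0 : (0 : ℝ) < n := by exact_mod_cast hn
  set B := Metric.ball x₀ ρ with hB
  have hBm : MeasurableSet B := Metric.isOpen_ball.measurableSet
  set M := levelMeasure P 𝓕 t₁ t₂ B w with hM
  set L := lInftyL2Norm P t₁ t₂ B w with hLdef
  have hL : L ≠ ∞ := fun h => hfin (by simp [v2NormSq, ← hLdef, h])
  set b := ((C * n ^ 2 : ℝ≥0) : ℝ≥0∞) ^ (n / (n + 2) : ℝ) * M ^ (2 / (n + 2) : ℝ) with hb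
  have hbtop : b ≠ ∞ := ENNReal.mul_ne_top
    (ENNReal.rpow_ne_top_of_nonneg (by positivity) ENNReal.coe_ne_top)
    (ENNReal.rpow_ne_top_of_nonneg (by positivity) (levelMeasure_ne_top Metric.isBounded_ball w))
  have key : ∀ G, IsRandomGradient P 𝓕 t₁ t₂ B w G →
      mNorm 2 P 𝓕 t₁ t₂ B w ^ 2 ≤ b * (L ^ 2 + mNorm 2 P 𝓕 t₁ t₂ B G ^ 2) := by
    intro G hG
    rw [mNorm_sq_le_iff hw]
    intro s hs A hA
    set g := mNorm 2 P 𝓕 t₁ t₂ B G ^ 2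
    have hmA := hw.mono_measure (cylMeasure_mono (subset_univ A) hs.1 le_rfl subset_rfl)
    have h1 := lintegral_rpow_le_of_gradient (𝓕 := 𝓕) (K := ((C * n ^ 2 : ℝ≥0) : ℝ≥0∞))
      (p := 2 + 4 / n) (c := 2 / n)
      ENNReal.coe_ne_top (by positivity) (by
        filter_upwards [hG.ae_grad] with q hq
        exact gagliardo_nirenberg_of_hasW12Gradient hC hr hq (hsupp _ _)) hw hL hs hA
    have h2 := (levelMeasure_le_iff (𝓕 := 𝓕) hBm hw).1 le_rfl s hs A hA
    refine (lintegral_sq_le_rpow_mul_measure_pos hmA (fun p => hw0 _ _ _) hn).trans ?_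
    have hθ : (0 : ℝ) ≤ n / (n + 2) := by positivity
    have hθ' : (0 : ℝ) ≤ 2 / (n + 2) := by positivity
    have hsum : (n / (n + 2) + 2 / (n + 2) : ℝ) = 1 := by field_simp
    have split : ∀ a : ℝ≥0∞, a ^ (n / (n + 2) : ℝ) * a ^ (2 / (n + 2) : ℝ) = a := fun a => by
      rw [← ENNReal.rpow_add_of_nonneg _ _ hθ hθ', hsum, ENNReal.rpow_one]
    calc _ ≤ (((C * n ^ 2 : ℝ≥0) : ℝ≥0∞) * (L ^ 2) ^ (2 / n : ℝ) * (g * P A)) ^ (n / (n + 2) : ℝ) *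
          (M * P A) ^ (2 / (n + 2) : ℝ) := by gcongr
      _ = b * ((L ^ 2) ^ (2 / (n + 2) : ℝ) * g ^ (n / (n + 2) : ℝ)) *
          (P A ^ (n / (n + 2) : ℝ) * P A ^ (2 / (n + 2) : ℝ)) := by
        have e : ((L ^ 2) ^ (2 / n : ℝ)) ^ (n / (n + 2) : ℝ) = (L ^ 2) ^ (2 / (n + 2) : ℝ) := by
          rw [← ENNReal.rpow_mul]; congr 1; field_simp
        rw [ENNReal.mul_rpow_of_nonneg _ _ hθ, ENNReal.mul_rpow_of_nonneg _ _ hθ,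
          ENNReal.mul_rpow_of_nonneg _ _ hθ, ENNReal.mul_rpow_of_nonneg _ _ hθ', e, hb]
        ring
      _ ≤ b * ((L ^ 2 + g) ^ (n / (n + 2) : ℝ) * (L ^ 2 + g) ^ (2 / (n + 2) : ℝ)) * P A := by
        rw [split (P A), mul_comm ((L ^ 2) ^ (2 / (n + 2) : ℝ))]
        gcongr
        · exact le_add_self
        · exact le_self_add
      _ = b * (L ^ 2 + g) * P A := by rw [split]
  -- `b` has to be divided out to pass to the infimum over all gradients
  rcases eq_or_ne b 0 with hb0 | hb0
  · have : ∃ G, IsRandomGradient P 𝓕 t₁ t₂ B w G := by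
      by_contra! hne
      exact hfin (by simp [v2NormSq, hne])
    obtain ⟨G, hG⟩ := this
    simpa [hb0] using key G hG
  · rw [mul_comm, ← ENNReal.div_le_iff_le_mul (.inl hb0) (.inl hbtop), v2NormSq, ENNReal.add_iInf₂]
    refine le_iInf₂ fun G hG => ?_
    rw [ENNReal.div_le_iff_le_mul (.inl hb0) (.inl hbtop), mul_comm]
    exact key G hG

end

/-! ### Cut-off functions with explicit derivative bounds -/

section

theorem exists_abs_deriv_smoothTransition_le :
    ∃ M : ℝ, 0 < M ∧ ∀ x, |deriv Real.smoothTransition x| ≤ M := by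
  have hc : Continuous (deriv Real.smoothTransition) :=
    (Real.smoothTransition.contDiff (n := 1)).continuous_deriv_one
  have hsupp : HasCompactSupport (deriv Real.smoothTransition) := by
    refine HasCompactSupport.intro (isCompact_Icc (a := (0 : ℝ)) (b := 1)) fun x hx => ?_
    rw [mem_Icc, not_and_or, not_le, not_le] at hx
    rcases hx with hx | hx
    · have : Real.smoothTransition =ᶠ[𝓝 x] fun _ => 0 := by
        filter_upwards [Iio_mem_nhds hx] with y hy
        exact Real.smoothTransition.zero_of_nonpos (le_of_lt hy)
      rw [this.deriv_eq, deriv_const]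
    · have : Real.smoothTransition =ᶠ[𝓝 x] fun _ => 1 := by
        filter_upwards [Ioi_mem_nhds hx] with y hy
        exact Real.smoothTransition.one_of_one_le (le_of_lt hy)
      rw [this.deriv_eq, deriv_const]
  obtain ⟨M, hM⟩ := hsupp.exists_bound_of_continuous hc
  exact ⟨max M 1, by positivity, fun x => (hM x).trans (le_max_left _ _)⟩

section Radial

variable {E : Type*} [NormedAddCommGroup E]

/-- The smooth function equal to `1` on the closed ball of radius `r` about `c` and to `0` off the
open ball of radius `R`. Unlike for `ContDiffBump`, its gradient has an explicit bound, of order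
`1 / (R - r)`; squared norms make it smooth at the centre. -/
def radialCutoff (c : E) (r R : ℝ) (x : E) : ℝ :=
  Real.smoothTransition ((R ^ 2 - ‖x - c‖ ^ 2) / (R ^ 2 - r ^ 2))

variable {c : E} {r R : ℝ}

theorem radialCutoff_nonneg (x : E) : 0 ≤ radialCutoff c r R x :=
  Real.smoothTransition.nonneg _

theorem radialCutoff_le_one (x : E) : radialCutoff c r R x ≤ 1 :=
  Real.smoothTransition.le_one _

theorem radialCutoff_eq_one (hr : 0 < r) (hrR : r < R) {x : E} (hx : dist x c ≤ r) :
    radialCutoff c r R x = 1 := by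
  have h : 0 < R ^ 2 - r ^ 2 := by nlinarith
  refine Real.smoothTransition.one_of_one_le ?_
  rw [one_le_div h, ← dist_eq_norm]
  have : dist x c ^ 2 ≤ r ^ 2 := pow_le_pow_left₀ dist_nonneg hx 2
  linarith

theorem radialCutoff_eq_zero (hr : 0 < r) (hrR : r < R) {x : E} (hx : R ≤ dist x c) :
    radialCutoff c r R x = 0 := by
  have h : 0 < R ^ 2 - r ^ 2 := by nlinarith
  refine Real.smoothTransition.zero_of_nonpos (div_nonpos_of_nonpos_of_nonneg ?_ h.le)
  rw [← dist_eq_norm]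
  have : R ^ 2 ≤ dist x c ^ 2 := pow_le_pow_left₀ (by linarith) hx 2
  linarith

variable [InnerProductSpace ℝ E]

theorem contDiff_radialCutoff {k : ℕ∞} : ContDiff ℝ k (radialCutoff c r R) :=
  Real.smoothTransition.contDiff.comp
    ((contDiff_const.sub ((contDiff_id.sub contDiff_const).norm_sq ℝ)).div_const _)

theorem norm_fderiv_radialCutoff_le {M : ℝ} (hM0 : 0 < M)
    (hM : ∀ x, |deriv Real.smoothTransition x| ≤ M) (hr : 0 < r) (hrR : r < R) (x : E) :
    ‖fderiv ℝ (radialCutoff c r R) x‖ ≤ 2 * M / (R - r) := by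
  have h : 0 < R ^ 2 - r ^ 2 := by nlinarith
  have hb : 0 ≤ 2 * M / (R - r) := div_nonneg (by positivity) (by linarith)
  rcases le_or_gt (dist x c) R with hx | hx
  · have h1 : HasFDerivAt (fun x : E => ‖x - c‖ ^ 2)
        ((2 • innerSL ℝ (x - c)).comp (ContinuousLinearMap.id ℝ E)) x :=
      HasFDerivAt.comp (g := fun y : E => ‖y‖ ^ 2) x (hasStrictFDerivAt_norm_sq (x - c)).hasFDerivAt
        ((hasFDerivAt_id x).sub_const c)
    have h2 := (h1.const_sub (R ^ 2)).mul_const ((R ^ 2 - r ^ 2)⁻¹)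
    have h3 := (((Real.smoothTransition.contDiff (n := 1)).differentiable one_ne_zero
      ((R ^ 2 - ‖x - c‖ ^ 2) * (R ^ 2 - r ^ 2)⁻¹)).hasDerivAt).comp_hasFDerivAt x h2
    have h4 : HasFDerivAt (radialCutoff c r R) _ x := h3
    rw [h4.fderiv]
    simp only [ContinuousLinearMap.comp_id, norm_smul, norm_neg, Real.norm_eq_abs, norm_inv]
    have h5 : ‖(2 : ℕ) • (innerSL ℝ (x - c))‖ ≤ 2 * R := by
      refine (norm_nsmul_le).trans ?_
      rw [innerSL_apply_norm, ← dist_eq_norm]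
      push_cast; linarith
    calc _ ≤ M * ((R ^ 2 - r ^ 2)⁻¹ * (2 * R)) := by
          rw [abs_of_pos h]
          gcongr
          exact hM _
      _ ≤ 2 * M / (R - r) := by
          rw [show R ^ 2 - r ^ 2 = (R - r) * (R + r) by ring, le_div_iff₀ (by linarith)]
          have h6 : R - r ≠ 0 := by linarith
          have h7 : 0 < R + r := by linarith
          have : M * (((R - r) * (R + r))⁻¹ * (2 * R)) * (R - r) = 2 * M * (R / (R + r)) := by
            field_simp
          rw [this]
          refine mul_le_of_le_one_right (by positivity) ?_
          rw [div_le_one h7]; linarith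
  · have : radialCutoff c r R =ᶠ[𝓝 x] fun _ => 0 := by
      filter_upwards [Metric.isClosed_closedBall.isOpen_compl.mem_nhds
        (show x ∈ (Metric.closedBall c R)ᶜ by simpa using hx)] with y hy
      exact radialCutoff_eq_zero hr hrR (le_of_not_ge hy)
    rw [this.fderiv_eq, fderiv_fun_const, Pi.zero_apply, norm_zero]
    exact hb

end Radial

variable {n : ℕ}

/-- The product of a radial cut-off in time about the initial time `t₁` and a radial cut-off in
space. Only `t ≥ t₁` matters; the cut-off for `t < t₁` gives compact support. -/
def cylCutoff (t₁ s S : ℝ) (x₀ : EuclideanSpace ℝ (Fin n)) (r R : ℝ)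
    (q : ℝ × EuclideanSpace ℝ (Fin n)) : ℝ :=
  radialCutoff t₁ s S q.1 * radialCutoff x₀ r R q.2

variable {t₁ t₂ s S r R ρ : ℝ} {x₀ : EuclideanSpace ℝ (Fin n)}

theorem contDiff_cylCutoff {k : ℕ∞} : ContDiff ℝ k (cylCutoff t₁ s S x₀ r R) :=
  (contDiff_radialCutoff.comp contDiff_fst).mul (contDiff_radialCutoff.comp contDiff_snd)

theorem cylCutoff_mem_Icc (q : ℝ × EuclideanSpace ℝ (Fin n)) :
    cylCutoff t₁ s S x₀ r R q ∈ Icc (0 : ℝ) 1 :=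
  ⟨mul_nonneg (radialCutoff_nonneg _) (radialCutoff_nonneg _),
    mul_le_one₀ (radialCutoff_le_one _) (radialCutoff_nonneg _) (radialCutoff_le_one _)⟩

theorem cylCutoff_eq_one (hs : 0 < s) (hsS : s < S) (hr : 0 < r) (hrR : r < R)
    {q : ℝ × EuclideanSpace ℝ (Fin n)} (ht : q.1 ∈ Icc t₁ (t₁ + s)) (hx : dist q.2 x₀ ≤ r) :
    cylCutoff t₁ s S x₀ r R q = 1 := by
  rw [cylCutoff, radialCutoff_eq_one hs hsS, radialCutoff_eq_one hr hrR hx, one_mul]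
  rw [Real.dist_eq, abs_of_nonneg (by linarith [ht.1])]
  linarith [ht.2]

theorem cylCutoff_eq_zero_of_space (hr : 0 < r) (hrR : r < R)
    {q : ℝ × EuclideanSpace ℝ (Fin n)} (hx : R ≤ dist q.2 x₀) :
    cylCutoff t₁ s S x₀ r R q = 0 := by
  rw [cylCutoff, radialCutoff_eq_zero hr hrR hx, mul_zero]

theorem cylCutoff_eq_zero_of_time (hs : 0 < s) (hsS : s < S)
    {q : ℝ × EuclideanSpace ℝ (Fin n)} (ht : S ≤ dist q.1 t₁) :
    cylCutoff t₁ s S x₀ r R q = 0 := by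
  rw [cylCutoff, radialCutoff_eq_zero hs hsS ht, zero_mul]

theorem support_cylCutoff_subset (hs : 0 < s) (hsS : s < S) (hr : 0 < r) (hrR : r < R) :
    Function.support (cylCutoff t₁ s S x₀ r R) ⊆
      Metric.closedBall t₁ S ×ˢ Metric.closedBall x₀ R := by
  intro q hq
  refine ⟨?_, ?_⟩
  · by_contra h
    exact hq (cylCutoff_eq_zero_of_time hs hsS (by simpa using le_of_not_ge h))
  · by_contra h
    exact hq (cylCutoff_eq_zero_of_space hr hrR (by simpa using le_of_not_ge h))

theorem deriv_cylCutoff (q : ℝ × EuclideanSpace ℝ (Fin n)) :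
    deriv (fun t => cylCutoff t₁ s S x₀ r R (t, q.2)) q.1 =
      deriv (radialCutoff t₁ s S) q.1 * radialCutoff x₀ r R q.2 := by
  simp only [cylCutoff]
  rw [deriv_mul_const_field]

theorem gradient_cylCutoff (q : ℝ × EuclideanSpace ℝ (Fin n)) :
    gradient (fun x => cylCutoff t₁ s S x₀ r R (q.1, x)) q.2 =
      radialCutoff t₁ s S q.1 • gradient (radialCutoff x₀ r R) q.2 := by
  simp only [cylCutoff, gradient]
  rw [fderiv_const_mul (contDiff_radialCutoff (k := 1).differentiable one_ne_zero _)]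
  simp

theorem continuous_gradient {f : EuclideanSpace ℝ (Fin n) → ℝ} (hf : ContDiff ℝ 1 f) :
    Continuous (gradient f) :=
  (InnerProductSpace.toDual ℝ (EuclideanSpace ℝ (Fin n))).symm.continuous.comp
    (hf.continuous_fderiv one_ne_zero)

theorem eLpNorm_deriv_cylCutoff_le {M : ℝ} (hM0 : 0 < M)
    (hM : ∀ x, |deriv Real.smoothTransition x| ≤ M) (hs : 0 < s) (hsS : s < S)
    (ν : Measure (ℝ × EuclideanSpace ℝ (Fin n))) :
    eLpNorm (fun q => deriv (fun t => cylCutoff t₁ s S x₀ r R (t, q.2)) q.1) ∞ ν ≤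
      ENNReal.ofReal (2 * M / (S - s)) := by
  rw [eLpNorm_exponent_top]
  refine eLpNormEssSup_le_of_ae_bound (.of_forall fun q => ?_)
  rw [deriv_cylCutoff, norm_mul]
  have h1 := norm_fderiv_radialCutoff_le (c := t₁) hM0 hM hs hsS q.1
  rw [← norm_deriv_eq_norm_fderiv] at h1
  have h2 : ‖radialCutoff x₀ r R q.2‖ ≤ 1 := by
    rw [Real.norm_of_nonneg (radialCutoff_nonneg _)]; exact radialCutoff_le_one _
  exact (mul_le_of_le_one_right (norm_nonneg _) h2).trans h1

theorem eLpNorm_gradient_cylCutoff_le {M : ℝ} (hM0 : 0 < M)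
    (hM : ∀ x, |deriv Real.smoothTransition x| ≤ M) (hr : 0 < r) (hrR : r < R)
    (ν : Measure (ℝ × EuclideanSpace ℝ (Fin n))) :
    eLpNorm (fun q => gradient (fun x => cylCutoff t₁ s S x₀ r R (q.1, x)) q.2) ∞ ν ≤
      ENNReal.ofReal (2 * M / (R - r)) := by
  rw [eLpNorm_exponent_top]
  refine eLpNormEssSup_le_of_ae_bound (.of_forall fun q => ?_)
  rw [gradient_cylCutoff, norm_smul]
  have h1 := norm_fderiv_radialCutoff_le (c := x₀) hM0 hM hr hrR q.2
  have h2 : ‖radialCutoff t₁ s S q.1‖ ≤ 1 := by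
    rw [Real.norm_of_nonneg (radialCutoff_nonneg _)]; exact radialCutoff_le_one _
  have h3 : ‖gradient (radialCutoff x₀ r R) q.2‖ = ‖fderiv ℝ (radialCutoff x₀ r R) q.2‖ :=
    LinearIsometryEquiv.norm_map _ _
  rw [h3]
  exact (mul_le_of_le_one_left (norm_nonneg _) h2).trans h1

theorem isCutoff_cylCutoff (hs : 0 < s) (hsS : s < S) (hS : t₁ + S < t₂) (hr : 0 < r)
    (hrR : r < R) (hR : R < ρ) :
    IsCutoff t₁ t₂ x₀ ρ (cylCutoff t₁ s S x₀ r R)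
      (fun q => deriv (fun t => cylCutoff t₁ s S x₀ r R (t, q.2)) q.1)
      (fun q => gradient (fun x => cylCutoff t₁ s S x₀ r R (q.1, x)) q.2) where
  approx := by
    refine ⟨fun _ => cylCutoff t₁ s S x₀ r R, fun i j q => fderiv ℝ (fun y =>
      fderiv ℝ (fun x => cylCutoff t₁ s S x₀ r R (q.1, x)) y (EuclideanSpace.single i 1))
        q.2 (EuclideanSpace.single j 1), fun _ => ⟨contDiff_cylCutoff, ?_, ?_⟩, ?_, ?_, ?_, ?_⟩
    · refine HasCompactSupport.intro ((isCompact_closedBall t₁ S).prod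
        (isCompact_closedBall x₀ R)) fun q hq => ?_
      by_contra h
      exact hq (support_cylCutoff_subset hs hsS hr hrR h)
    · refine (closure_minimal (support_cylCutoff_subset hs hsS hr hrR)
        (Metric.isClosed_closedBall.prod Metric.isClosed_closedBall)).trans
        (prod_mono (fun t ht => ?_) (Metric.closedBall_subset_ball hR))
      have := (abs_le.1 (Real.dist_eq t t₁ ▸ Metric.mem_closedBall.1 ht)).2
      exact mem_Iio.2 (by linarith)
    all_goals simp
  aestronglyMeasurable := (contDiff_cylCutoff (k := 0)).continuous.aestronglyMeasurable
  aestronglyMeasurable_dt := by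
    simp_rw [deriv_cylCutoff]
    exact (((contDiff_radialCutoff (k := 1)).continuous_deriv_one.comp continuous_fst).mul
      ((contDiff_radialCutoff (k := 0)).continuous.comp continuous_snd)).aestronglyMeasurable
  aestronglyMeasurable_grad := by
    simp_rw [gradient_cylCutoff]
    exact (((contDiff_radialCutoff (k := 0)).continuous.comp continuous_fst).smul
      ((continuous_gradient (contDiff_radialCutoff (k := 1))).comp
        continuous_snd)).aestronglyMeasurable
  mem_Icc := fun q _ => cylCutoff_mem_Icc q
  exists_domains := by
    have hIco : ∀ {a : ℝ}, a ≤ S → Ico t₁ (t₁ + a) = Ioo (t₁ - 1) (t₁ + a) ∩ Ico t₁ t₂ := by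
      intro a ha
      ext t; simp only [mem_Ico, mem_inter_iff, mem_Ioo]
      constructor
      · rintro ⟨h1, h2⟩; exact ⟨⟨by linarith, h2⟩, h1, by linarith⟩
      · rintro ⟨⟨_, h2⟩, h1, _⟩; exact ⟨h1, h2⟩
    have hdom : ∀ {a b : ℝ}, a ≤ S → b ≤ ρ → IsDomainOf (Ico t₁ (t₁ + a) ×ˢ Metric.ball x₀ b)
        (Ico t₁ t₂ ×ˢ Metric.ball x₀ ρ) := by
      intro a b ha hb
      refine ⟨⟨Ioo (t₁ - 1) (t₁ + a) ×ˢ Metric.ball x₀ b, isOpen_Ioo.prod Metric.isOpen_ball, ?_⟩,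
        isPreconnected_Ico.prod (convex_ball x₀ b).isPreconnected⟩
      rw [prod_inter_prod, ← hIco ha, inter_eq_left.2 (Metric.ball_subset_ball hb)]
    have hclos : ∀ {a b : ℝ}, closure (Ico t₁ (t₁ + a) ×ˢ Metric.ball x₀ b) ⊆
        Icc t₁ (t₁ + a) ×ˢ Metric.closedBall x₀ b := fun {a b} =>
      closure_minimal (prod_mono Ico_subset_Icc_self Metric.ball_subset_closedBall)
        (isClosed_Icc.prod Metric.isClosed_closedBall)
    refine ⟨Ico t₁ (t₁ + S) ×ˢ Metric.ball x₀ R, Ico t₁ (t₁ + s) ×ˢ Metric.ball x₀ r,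
      hdom le_rfl hR.le, hclos.trans (prod_mono (fun t ht => ⟨ht.1, ht.2.trans_lt hS⟩)
        (Metric.closedBall_subset_ball hR)), hdom hsS.le (by linarith),
      ⟨(t₁, x₀), ⟨le_rfl, by simpa using hs⟩, Metric.mem_ball_self hr⟩,
      hclos.trans (prod_mono (fun t ht => ⟨ht.1, ht.2.trans_lt (by linarith)⟩)
        (Metric.closedBall_subset_ball hrR)), fun q hq => ?_, fun q hq => ?_⟩
    · exact cylCutoff_eq_one hs hsS hr hrR (Ico_subset_Icc_self hq.1) (le_of_lt hq.2)
    · by_cases hx : R ≤ dist q.2 x₀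
      · exact cylCutoff_eq_zero_of_space hr hrR hx
      · refine cylCutoff_eq_zero_of_time hs hsS ?_
        by_contra! ht
        refine hq.2 ⟨⟨hq.1.1.1, ?_⟩, by simpa using hx⟩
        have := (abs_lt.1 (Real.dist_eq q.1 t₁ ▸ ht)).2
        linarith
  grad_bounded := by
    obtain ⟨M, hM0, hM⟩ := exists_abs_deriv_smoothTransition_le
    exact (eLpNorm_gradient_cylCutoff_le hM0 hM hr hrR _).trans_lt ENNReal.ofReal_lt_top
  dt_bounded := by
    obtain ⟨M, hM0, hM⟩ := exists_abs_deriv_smoothTransition_le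
    exact (eLpNorm_deriv_cylCutoff_le hM0 hM hs hsS _).trans_lt ENNReal.ofReal_lt_top

end

/-! ### The De Giorgi step -/

section

variable {n : ℕ} {Ω : Type*} {mΩ : MeasurableSpace Ω} {P : Measure Ω} {𝓕 : Filtration ℝ≥0 mΩ}
  {t₁ t₂ t₂' : ℝ} {B B' : Set (EuclideanSpace ℝ (Fin n))}

theorem essSupCondExp_mono {X X' : ℝ → Ω → ℝ≥0∞} (ht : t₂' ≤ t₂)
    (h : ∀ s ∈ Icc t₁ t₂', ∀ ω, X' s ω ≤ X s ω) :
    essSupCondExp P 𝓕 t₁ t₂' X' ≤ essSupCondExp P 𝓕 t₁ t₂ X :=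
  iSup₂_le fun s hs => (essSup_mono_ae (condLExp_mono (.of_forall (h s hs)))).trans
    (le_iSup₂_of_le s ⟨hs.1, hs.2.trans ht⟩ le_rfl)

theorem mNorm_sq_mono {w w' : Ω → ℝ → EuclideanSpace ℝ (Fin n) → ℝ} (ht : t₂' ≤ t₂)
    (hBm : MeasurableSet B') (hB : B' ⊆ B)
    (h : ∀ ω, ∀ t ∈ Icc t₁ t₂', ∀ x ∈ B', ‖w' ω t x‖ₑ ≤ ‖w ω t x‖ₑ) :
    mNorm 2 P 𝓕 t₁ t₂' B' w' ^ 2 ≤ mNorm 2 P 𝓕 t₁ t₂ B w ^ 2 := by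
  rw [mNorm_two_sq, mNorm_two_sq]
  refine essSupCondExp_mono ht fun s hs ω => ?_
  calc ∫⁻ τ in Icc s t₂', ∫⁻ x in B', ‖w' ω τ x‖ₑ ^ (2 : ℝ)
      ≤ ∫⁻ τ in Icc s t₂', ∫⁻ x in B, ‖w ω τ x‖ₑ ^ (2 : ℝ) := by
        refine setLIntegral_mono' measurableSet_Icc fun τ hτ => ?_
        refine (setLIntegral_mono' hBm fun x hx => ?_).trans (lintegral_mono_set hB)
        exact ENNReal.rpow_le_rpow (h ω τ ⟨hs.1.trans hτ.1, hτ.2⟩ x hx) zero_le_two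
    _ ≤ _ := lintegral_mono_set (Icc_subset_Icc_right ht)

theorem levelMeasure_mono {w w' : Ω → ℝ → EuclideanSpace ℝ (Fin n) → ℝ}
    (h : ∀ ω t x, 0 < w' ω t x → 0 < w ω t x) :
    levelMeasure P 𝓕 t₁ t₂ B w' ≤ levelMeasure P 𝓕 t₁ t₂ B w :=
  essSupCondExp_mono le_rfl fun _ _ ω => measure_mono fun _ hq => ⟨hq.1, hq.2.1, h ω _ _ hq.2.2⟩

/-- Chebyshev's inequality between two levels. -/
theorem levelMeasure_le_mNorm_sq_div [IsFiniteMeasure P] (hB : MeasurableSet B)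
    {u : Ω → ℝ → EuclideanSpace ℝ (Fin n) → ℝ}
    (hu : AEMeasurable (fun p : Ω × (ℝ × EuclideanSpace ℝ (Fin n)) => u p.1 p.2.1 p.2.2)
      (cylMeasure P univ t₁ t₂ B)) {h k : ℝ} (hhk : h < k) :
    levelMeasure P 𝓕 t₁ t₂ B (fun ω t x => (u ω t x - k)⁺) ≤
      mNorm 2 P 𝓕 t₁ t₂ B (fun ω t x => (u ω t x - h)⁺) ^ 2 / ENNReal.ofReal ((k - h) ^ 2) := by
  have hpos : ∀ l : ℝ, AEMeasurable (fun p : Ω × (ℝ × EuclideanSpace ℝ (Fin n)) =>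
      (u p.1 p.2.1 p.2.2 - l)⁺) (cylMeasure P univ t₁ t₂ B) := fun l =>
    (hu.sub_const l).sup_const 0
  have hδ : 0 < ENNReal.ofReal ((k - h) ^ 2) :=
    ENNReal.ofReal_pos.2 (pow_pos (by linarith) 2)
  rw [levelMeasure_le_iff hB (hpos k)]
  intro s hs A hA
  have h1 := (mNorm_sq_le_iff (𝓕 := 𝓕) (w := fun ω t x => (u ω t x - h)⁺) (hpos h)).1
    le_rfl s hs A hA
  have hm := ((hpos h).enorm.pow_const (2 : ℝ)).mono_measure
    (cylMeasure_mono (subset_univ A) hs.1 le_rfl subset_rfl)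
  have h2 := mul_meas_ge_le_lintegral₀ hm (ENNReal.ofReal ((k - h) ^ 2))
  rw [← ENNReal.mul_div_right_comm, ENNReal.le_div_iff_mul_le (.inl hδ.ne')
    (.inl ENNReal.ofReal_ne_top), mul_comm]
  refine le_trans ?_ (h2.trans h1)
  refine mul_le_mul_right (measure_mono fun p hp => ?_) _
  have hp' : k < u p.1 p.2.1 p.2.2 := by
    have := (posPart_pos_iff (a := u p.1 p.2.1 p.2.2 - k)).1 hp
    linarith
  have h3 : (u p.1 p.2.1 p.2.2 - h)⁺ = u p.1 p.2.1 p.2.2 - h := posPart_of_nonneg (by linarith)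
  rw [mem_ofPred_eq, h3, ← ofReal_norm, Real.norm_of_nonneg (by linarith),
    ENNReal.ofReal_rpow_of_nonneg (by linarith) zero_le_two, Real.rpow_two]
  refine ENNReal.ofReal_le_ofReal (pow_le_pow_left₀ (by linarith) (by linarith) 2)

/-- The Caccioppoli-type inequality of the De Giorgi class, for the truncation `r ↦ r⁺` and with
cylinders described by their initial time. -/
def LevelSetInequality (P : Measure Ω) (𝓕 : Filtration ℝ≥0 mΩ)
    (Q : Set (ℝ × EuclideanSpace ℝ (Fin n))) (a₀ μ γ : ℝ)
    (u : Ω → ℝ → EuclideanSpace ℝ (Fin n) → ℝ) : Prop :=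
  ∀ (k t₁ τ ρ : ℝ) (x₀ : EuclideanSpace ℝ (Fin n)), ρ ∈ Ioo (0 : ℝ) 1 → τ ∈ Ioo (0 : ℝ) 1 →
    Ico t₁ (t₁ + τ) ×ˢ Metric.ball x₀ ρ ⊆ Q →
    ∀ (ζ ζt : ℝ × EuclideanSpace ℝ (Fin n) → ℝ)
      (ζx : ℝ × EuclideanSpace ℝ (Fin n) → EuclideanSpace ℝ (Fin n)),
    IsCutoff t₁ (t₁ + τ) x₀ ρ ζ ζt ζx →
    v2NormSq P 𝓕 t₁ (t₁ + τ) (Metric.ball x₀ ρ) (fun ω t x => ζ (t, x) * (u ω t x - k)⁺) ≤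
      ENNReal.ofReal γ *
        (mNorm 2 P 𝓕 t₁ (t₁ + τ) (Metric.ball x₀ ρ) (fun ω t x => (u ω t x - k)⁺) ^ 2 *
            (1 + eLpNorm ζx ∞ (volume.restrict (Ico t₁ (t₁ + τ) ×ˢ Metric.ball x₀ ρ)) ^ 2 +
              eLpNorm ζt ∞ (volume.restrict (Ico t₁ (t₁ + τ) ×ˢ Metric.ball x₀ ρ))) +
          ENNReal.ofReal (k ^ 2 + a₀ ^ 2) *
            levelMeasure P 𝓕 t₁ (t₁ + τ) (Metric.ball x₀ ρ)
              (fun ω t x => (u ω t x - k)⁺) ^ (1 - 2 / μ))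

theorem IsBSPDGPlus.levelSetInequality {T a₀ μ γ : ℝ} {D : Set (EuclideanSpace ℝ (Fin n))}
    {u : Ω → ℝ → EuclideanSpace ℝ (Fin n) → ℝ} (hu : IsBSPDGPlus P 𝓕 T D a₀ μ γ u) :
    LevelSetInequality P 𝓕 (Icc 0 T ×ˢ D) a₀ μ γ u := by
  intro k t₁ τ ρ x₀ hρ hτ hQ ζ ζt ζx hζ
  have := hu.ineq k (t₁ + τ) τ ρ x₀ hρ hτ
  rw [add_sub_cancel_right] at this
  exact this hQ ζ ζt ζx hζ

/-- `(u + k)⁻ = (-u - k)⁺`, and only the square of the level enters the inequality. -/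
theorem IsBSPDGMinus.levelSetInequality_neg {T a₀ μ γ : ℝ} {D : Set (EuclideanSpace ℝ (Fin n))}
    {u : Ω → ℝ → EuclideanSpace ℝ (Fin n) → ℝ} (hu : IsBSPDGMinus P 𝓕 T D a₀ μ γ u) :
    LevelSetInequality P 𝓕 (Icc 0 T ×ˢ D) a₀ μ γ (fun ω t x => -u ω t x) := by
  intro k t₁ τ ρ x₀ hρ hτ hQ ζ ζt ζx hζ
  have := hu.ineq (-k) (t₁ + τ) τ ρ x₀ hρ hτ
  rw [add_sub_cancel_right] at this
  have h := this hQ ζ ζt ζx hζ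
  have e : ∀ r : ℝ, (r - -k)⁻ = (-r - k)⁺ := fun r => by
    rw [← posPart_neg]; congr 1; ring
  simpa only [e, neg_sq] using h

/-- One step of the De Giorgi iteration: raising the level from `h` to `k` and shrinking the
cylinder bounds the new energy by a superlinear function of a bound `y` for the old one. -/
theorem deGiorgi_step [IsFiniteMeasure P] (hn : 1 ≤ n) {C : ℝ≥0}
    (hC : ∀ f : EuclideanSpace ℝ (Fin n) → ℝ, ContDiff ℝ 1 f → HasCompactSupport f →
      ∫⁻ x, ‖f x‖ₑ ^ (2 + 4 / n : ℝ) ≤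
        C * (∫⁻ x, ‖f x‖ₑ ^ (2 : ℝ)) ^ (2 / n : ℝ) * ∫⁻ x, ‖fderiv ℝ f x‖ₑ ^ (2 : ℝ))
    {M : ℝ} (hM0 : 0 < M) (hM : ∀ x, |deriv Real.smoothTransition x| ≤ M)
    {Q : Set (ℝ × EuclideanSpace ℝ (Fin n))} {a₀ μ γ : ℝ} (hμ : 2 < μ)
    {u : Ω → ℝ → EuclideanSpace ℝ (Fin n) → ℝ} (hineq : LevelSetInequality P 𝓕 Q a₀ μ γ u)
    {x₀ : EuclideanSpace ℝ (Fin n)} {h k r ρ s τ : ℝ} (hhk : h < k)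
    (hr : 0 < r) (hrρ : r < ρ) (hρ : ρ < 1) (hs : 0 < s) (hsτ : s < τ) (hτ : τ < 1)
    (hQ : Ico t₁ (t₁ + τ) ×ˢ Metric.ball x₀ ρ ⊆ Q)
    (hu : AEMeasurable (fun p : Ω × (ℝ × EuclideanSpace ℝ (Fin n)) => u p.1 p.2.1 p.2.2)
      (cylMeasure P univ t₁ (t₁ + τ) (Metric.ball x₀ ρ)))
    {y : ℝ≥0∞} (hy : y ≠ ∞)
    (hle : mNorm 2 P 𝓕 t₁ (t₁ + τ) (Metric.ball x₀ ρ) (fun ω t x => (u ω t x - h)⁺) ^ 2 ≤ y) :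
    mNorm 2 P 𝓕 t₁ (t₁ + s) (Metric.ball x₀ r) (fun ω t x => (u ω t x - k)⁺) ^ 2 ≤
      (((C * n ^ 2 : ℝ≥0) : ℝ≥0∞) ^ (n / (n + 2) : ℝ) *
        (y / ENNReal.ofReal ((k - h) ^ 2)) ^ (2 / (n + 2) : ℝ)) *
      (ENNReal.ofReal γ * (y * (1 + ENNReal.ofReal (4 * M / (ρ - r)) ^ 2 +
          ENNReal.ofReal (4 * M / (τ - s))) +
        ENNReal.ofReal (k ^ 2 + a₀ ^ 2) *
          (y / ENNReal.ofReal ((k - h) ^ 2)) ^ (1 - 2 / μ))) := by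
  -- the cut-off lives on a cylinder half-way between the two, to be supported inside the larger one
  set R := (r + ρ) / 2 with hR
  set S := (s + τ) / 2 with hS
  have hrR : r < R := by linarith
  have hRρ : R < ρ := by linarith
  have hsS : s < S := by linarith
  have hSτ : S < τ := by linarith
  set B := Metric.ball x₀ ρ with hB
  have hBm : MeasurableSet B := Metric.isOpen_ball.measurableSet
  set ζ := cylCutoff t₁ s S x₀ r R with hζdef
  have hζ := isCutoff_cylCutoff (t₁ := t₁) (t₂ := t₁ + τ) (x₀ := x₀) hs hsS (by linarith) hr hrR hRρ
  have hcon := hineq k t₁ τ ρ x₀ ⟨hr.trans hrρ, hρ⟩ ⟨hs.trans hsτ, hτ⟩ hQ _ _ _ hζ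
  have e1 : 2 * M / (R - r) = 4 * M / (ρ - r) := by
    have : ρ - r ≠ 0 := by linarith
    have h2 : R - r = (ρ - r) / 2 := by rw [hR]; ring
    rw [h2]; field_simp; ring
  have e2 : 2 * M / (S - s) = 4 * M / (τ - s) := by
    have : τ - s ≠ 0 := by linarith
    have h2 : S - s = (τ - s) / 2 := by rw [hS]; ring
    rw [h2]; field_simp; ring
  have hgrad := eLpNorm_gradient_cylCutoff_le (t₁ := t₁) (s := s) (S := S) (x₀ := x₀) hM0 hM hr hrR
    (volume.restrict (Ico t₁ (t₁ + τ) ×ˢ B))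
  have hdt := eLpNorm_deriv_cylCutoff_le (t₁ := t₁) (x₀ := x₀) (r := r) (R := R) hM0 hM hs hsS
    (volume.restrict (Ico t₁ (t₁ + τ) ×ˢ B))
  rw [e1] at hgrad
  rw [e2] at hdt
  have hδ : ENNReal.ofReal ((k - h) ^ 2) ≠ 0 :=
    (ENNReal.ofReal_pos.2 (pow_pos (by linarith) 2)).ne'
  have hlevel : levelMeasure P 𝓕 t₁ (t₁ + τ) B (fun ω t x => (u ω t x - k)⁺) ≤
      y / ENNReal.ofReal ((k - h) ^ 2) :=
    (levelMeasure_le_mNorm_sq_div hBm hu hhk).trans (by gcongr)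
  have hnorm : mNorm 2 P 𝓕 t₁ (t₁ + τ) B (fun ω t x => (u ω t x - k)⁺) ^ 2 ≤ y := by
    refine (mNorm_sq_mono le_rfl hBm subset_rfl fun ω t _ x _ => ?_).trans hle
    rw [← ofReal_norm, ← ofReal_norm, Real.norm_of_nonneg (posPart_nonneg _),
      Real.norm_of_nonneg (posPart_nonneg _)]
    exact ENNReal.ofReal_le_ofReal (posPart_mono (by linarith))
  have hμ' : 0 ≤ 1 - 2 / μ := by
    have : 2 / μ ≤ 1 := by rw [div_le_one (by linarith)]; linarith
    linarith
  have hytop : y / ENNReal.ofReal ((k - h) ^ 2) ≠ ∞ := ENNReal.div_ne_top hy hδ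
  have hv : v2NormSq P 𝓕 t₁ (t₁ + τ) B (fun ω t x => ζ (t, x) * (u ω t x - k)⁺) ≤
      ENNReal.ofReal γ * (y * (1 + ENNReal.ofReal (4 * M / (ρ - r)) ^ 2 +
          ENNReal.ofReal (4 * M / (τ - s))) +
        ENNReal.ofReal (k ^ 2 + a₀ ^ 2) *
          (y / ENNReal.ofReal ((k - h) ^ 2)) ^ (1 - 2 / μ)) := by
    refine hcon.trans (mul_le_mul_right (add_le_add (mul_le_mul hnorm (add_le_add (add_le_add le_rfl
      (pow_le_pow_left₀ zero_le hgrad 2)) hdt) zero_le zero_le)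
      (mul_le_mul_right (ENNReal.rpow_le_rpow hlevel hμ') _)) _)
  have hvtop : v2NormSq P 𝓕 t₁ (t₁ + τ) B (fun ω t x => ζ (t, x) * (u ω t x - k)⁺) ≠ ∞ := by
    refine ne_top_of_le_ne_top ?_ hv
    refine ENNReal.mul_ne_top ENNReal.ofReal_ne_top (ENNReal.add_ne_top.2
      ⟨ENNReal.mul_ne_top hy ?_, ENNReal.mul_ne_top ENNReal.ofReal_ne_top
        (ENNReal.rpow_ne_top_of_nonneg hμ' hytop)⟩)
    simp
  have hsmall : mNorm 2 P 𝓕 t₁ (t₁ + s) (Metric.ball x₀ r) (fun ω t x => (u ω t x - k)⁺) ^ 2 ≤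
      mNorm 2 P 𝓕 t₁ (t₁ + τ) B (fun ω t x => ζ (t, x) * (u ω t x - k)⁺) ^ 2 := by
    refine mNorm_sq_mono (by linarith) Metric.isOpen_ball.measurableSet
      (Metric.ball_subset_ball hrρ.le) fun ω t ht x hx => ?_
    have h1 : ζ (t, x) = 1 :=
      cylCutoff_eq_one (q := (t, x)) hs hsS hr hrR ht (Metric.mem_ball.1 hx).le
    simp only [h1, one_mul, le_refl]
  have hmeas : AEMeasurable (fun p : Ω × (ℝ × EuclideanSpace ℝ (Fin n)) =>
      ζ (p.2.1, p.2.2) * (u p.1 p.2.1 p.2.2 - k)⁺) (cylMeasure P univ t₁ (t₁ + τ) B) := by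
    refine AEMeasurable.mul ?_ ((hu.sub_const k).sup_const 0)
    exact ((contDiff_cylCutoff (k := 0)).continuous.measurable.comp
      measurable_snd).aemeasurable
  refine hsmall.trans ((mNorm_sq_le_v2NormSq_mul_levelMeasure hn hC hRρ hmeas
    (fun ω t x => mul_nonneg (cylCutoff_mem_Icc _).1 (posPart_nonneg _))
    (fun ω t x _ hx => ?_) hvtop).trans ?_)
  · have h1 : ζ (t, x) = 0 := cylCutoff_eq_zero_of_space (q := (t, x)) hr hrR
      (by simpa using le_of_not_ge hx)
    exact (congrArg (· * (u ω t x - k)⁺) h1).trans (zero_mul _)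
  · have hlevel' : levelMeasure P 𝓕 t₁ (t₁ + τ) B (fun ω t x => ζ (t, x) * (u ω t x - k)⁺) ≤
        y / ENNReal.ofReal ((k - h) ^ 2) := by
      refine (levelMeasure_mono fun ω t x hx => ?_).trans hlevel
      exact pos_of_mul_pos_right hx (cylCutoff_mem_Icc _).1
    exact mul_le_mul (mul_le_mul_right (ENNReal.rpow_le_rpow hlevel' (by positivity)) _) hv
      zero_le zero_le

end

/-! ### The De Giorgi iteration -/

section

/-- The arithmetic of one De Giorgi step: with `N = n + 2`, energies `Y = κ² ρ^N Z` and
`Z ≤ 1`, one step at scale `2^{-l}` gives at most `A 16^l κ² ρ^N Z^{1 + ε}`,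
`ε = 2 / N - 2 / μ`. -/
theorem deGiorgi_step_arith {N μ a₀ κ ρ K γ M Z : ℝ} (hN : 2 ≤ N) (hμ : N < μ)
    (hκ : 0 < κ) (hρ : 0 < ρ) (hρ1 : ρ < 1) (hK : 0 ≤ K) (hγ : 0 ≤ γ) (hM : 0 ≤ M)
    (ha₀ : 0 ≤ a₀) (hκa : a₀ * ρ ^ (1 - N / μ) ≤ κ) (hZ : 0 ≤ Z) (hZ1 : Z ≤ 1)
    (l : ℕ) {k : ℝ} (hk : 0 ≤ k) (hkκ : k ≤ κ) :
    K * (κ ^ 2 * ρ ^ N * Z / (κ / 2 ^ (l + 1)) ^ 2) ^ (2 / N) *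
      (γ * (κ ^ 2 * ρ ^ N * Z * (1 + (4 * M / (ρ / 2 ^ (l + 2))) ^ 2 +
          4 * M / (ρ ^ 2 / 2 ^ (l + 2))) +
        (k ^ 2 + a₀ ^ 2) * (κ ^ 2 * ρ ^ N * Z / (κ / 2 ^ (l + 1)) ^ 2) ^ (1 - 2 / μ))) ≤
      K * γ * (4 * (1 + 256 * M ^ 2 + 16 * M) + 32) * 16 ^ l * (κ ^ 2 * ρ ^ N) *
        Z ^ (1 + (2 / N - 2 / μ)) := by
  have hN0 : 0 < N := by linarith
  have hμ0 : 0 < μ := by linarith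
  have hε : 0 < 2 / N - 2 / μ := sub_pos.2 (div_lt_div_of_pos_left two_pos hN0 hμ)
  have hθ : 0 < 2 / N := by positivity
  have hθ1 : 2 / N ≤ 1 := by rw [div_le_one hN0]; exact hN
  have hη1 : 1 - 2 / μ ≤ 1 := by have : 0 < 2 / μ := by positivity
                                 linarith
  have hη : 0 ≤ 1 - 2 / μ := by
    have : 2 / μ ≤ 1 := by rw [div_le_one hμ0]; linarith
    linarith
  set F : ℝ := 4 ^ (l + 1) with hF
  have hF1 : 1 ≤ F := one_le_pow₀ (by norm_num)
  have hF0 : 0 < F := by linarith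
  have hρN : 0 < ρ ^ N := Real.rpow_pos_of_pos hρ _
  have hx : κ ^ 2 * ρ ^ N * Z / (κ / 2 ^ (l + 1)) ^ 2 = F * ρ ^ N * Z := by
    have h4 : ((2 : ℝ) ^ (l + 1)) ^ 2 = F := by rw [← pow_mul, mul_comm, pow_mul]; norm_num [hF]
    rw [div_pow, h4]; field_simp
  rw [hx]
  have hFpow : ∀ e : ℝ, e ≤ 1 → F ^ e ≤ F := fun e he => by
    calc F ^ e ≤ F ^ (1 : ℝ) := Real.rpow_le_rpow_of_exponent_le hF1 he
      _ = F := Real.rpow_one _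
  have hA : (F * ρ ^ N * Z) ^ (2 / N) ≤ F * ρ ^ 2 * Z ^ (2 / N) := by
    rw [Real.mul_rpow (by positivity) hZ, Real.mul_rpow hF0.le hρN.le, ← Real.rpow_mul hρ.le,
      show N * (2 / N) = (2 : ℕ) by field_simp; norm_num, Real.rpow_natCast]
    gcongr
    exact hFpow _ hθ1
  have hB : (F * ρ ^ N * Z) ^ (1 - 2 / μ) ≤ F * ρ ^ (N - 2 * (N / μ)) * Z ^ (1 - 2 / μ) := by
    rw [Real.mul_rpow (by positivity) hZ, Real.mul_rpow hF0.le hρN.le, ← Real.rpow_mul hρ.le,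
      show N * (1 - 2 / μ) = N - 2 * (N / μ) by ring]
    gcongr
    exact hFpow _ hη1
  -- the lower bound on `κ` absorbs `a₀` at the cost of a negative power of `ρ`
  have hka : k ^ 2 + a₀ ^ 2 ≤ 2 * κ ^ 2 * ρ ^ (-(2 - 2 * (N / μ))) := by
    have hNμ : N / μ < 1 := by rw [div_lt_one hμ0]; exact hμ
    have h1 : 1 ≤ ρ ^ (-(2 - 2 * (N / μ))) :=
      Real.one_le_rpow_of_pos_of_le_one_of_nonpos hρ hρ1.le (by linarith)
    have h2 : a₀ ^ 2 ≤ κ ^ 2 * ρ ^ (-(2 - 2 * (N / μ))) := by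
      rw [Real.rpow_neg hρ.le, ← div_eq_mul_inv, le_div_iff₀ (Real.rpow_pos_of_pos hρ _)]
      have h3 : ρ ^ (2 - 2 * (N / μ)) = (ρ ^ (1 - N / μ)) ^ 2 := by
        rw [← Real.rpow_natCast, ← Real.rpow_mul hρ.le]; congr 1; push_cast; ring
      rw [h3, ← mul_pow]
      exact pow_le_pow_left₀ (by positivity) hκa 2
    have h4 : k ^ 2 ≤ κ ^ 2 * ρ ^ (-(2 - 2 * (N / μ))) :=
      (pow_le_pow_left₀ hk hkκ 2).trans (le_mul_of_one_le_right (by positivity) h1)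
    linarith
  have hgrad : 1 + (4 * M / (ρ / 2 ^ (l + 2))) ^ 2 + 4 * M / (ρ ^ 2 / 2 ^ (l + 2)) ≤
      (1 + 256 * M ^ 2 + 16 * M) * 4 ^ l * ρ⁻¹ ^ 2 := by
    have h2l : (2 : ℝ) ^ l ≤ 4 ^ l := pow_le_pow_left₀ (by norm_num) (by norm_num) l
    have h4l : (1 : ℝ) ≤ 4 ^ l := one_le_pow₀ (by norm_num)
    have hρi : 1 ≤ ρ⁻¹ ^ 2 := one_le_pow₀ ((one_le_inv₀ hρ).2 hρ1.le)
    have h22 : ((2 : ℝ) ^ l) ^ 2 = 4 ^ l := by rw [← pow_mul, mul_comm, pow_mul]; norm_num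
    have e1 : (4 * M / (ρ / 2 ^ (l + 2))) ^ 2 = 256 * M ^ 2 * 4 ^ l * ρ⁻¹ ^ 2 := by
      rw [← h22, pow_add]; field_simp; ring
    have e2 : 4 * M / (ρ ^ 2 / 2 ^ (l + 2)) = 16 * M * 2 ^ l * ρ⁻¹ ^ 2 := by
      rw [pow_add]; field_simp; ring
    rw [e1, e2]
    have e3 : 16 * M * 2 ^ l * ρ⁻¹ ^ 2 ≤ 16 * M * 4 ^ l * ρ⁻¹ ^ 2 := by gcongr
    have e4 : 1 ≤ (4 : ℝ) ^ l * ρ⁻¹ ^ 2 := one_le_mul_of_one_le_of_one_le h4l hρi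
    nlinarith
  have hZa : Z ^ (2 / N) * Z ≤ Z ^ (1 + (2 / N - 2 / μ)) := by
    rcases hZ.eq_or_lt with h0 | h0
    · rw [← h0, mul_zero]; positivity
    · rw [← Real.rpow_add_one h0.ne']
      refine Real.rpow_le_rpow_of_exponent_ge h0 hZ1 ?_
      have : 0 < 2 / μ := by positivity
      linarith
  have hZb : Z ^ (2 / N) * Z ^ (1 - 2 / μ) = Z ^ (1 + (2 / N - 2 / μ)) := by
    rw [← Real.rpow_add_of_nonneg hZ hθ.le hη]; congr 1; ring
  -- the powers of `ρ` recombine exactly: the estimate is scale invariant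
  have hρρ : ρ ^ (-(2 - 2 * (N / μ))) * ρ ^ (N - 2 * (N / μ)) * ρ ^ 2 = ρ ^ N := by
    rw [← Real.rpow_natCast, ← Real.rpow_add hρ, ← Real.rpow_add hρ]; congr 1; push_cast; ring
  have hFF : F * F = 16 * 16 ^ l := by
    rw [hF, ← mul_pow, pow_succ]; norm_num; ring
  have hF4 : F * 4 ^ l = 4 * 16 ^ l := by
    rw [hF, pow_succ, mul_right_comm, ← mul_pow]; norm_num; ring
  calc _ ≤ K * (F * ρ ^ 2 * Z ^ (2 / N)) *
      (γ * (κ ^ 2 * ρ ^ N * Z * ((1 + 256 * M ^ 2 + 16 * M) * 4 ^ l * ρ⁻¹ ^ 2) +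
        2 * κ ^ 2 * ρ ^ (-(2 - 2 * (N / μ))) *
          (F * ρ ^ (N - 2 * (N / μ)) * Z ^ (1 - 2 / μ)))) := by
        gcongr
    _ = K * γ * κ ^ 2 * ((1 + 256 * M ^ 2 + 16 * M) * (F * 4 ^ l) * ρ ^ N *
          (Z ^ (2 / N) * Z) * (ρ * ρ⁻¹) ^ 2 +
        2 * (F * F) * (ρ ^ (-(2 - 2 * (N / μ))) * ρ ^ (N - 2 * (N / μ)) * ρ ^ 2) *
          (Z ^ (2 / N) * Z ^ (1 - 2 / μ))) := by ring
    _ = K * γ * κ ^ 2 * ((1 + 256 * M ^ 2 + 16 * M) * (4 * 16 ^ l) * ρ ^ N *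
          (Z ^ (2 / N) * Z) +
        2 * (16 * 16 ^ l) * ρ ^ N * Z ^ (1 + (2 / N - 2 / μ))) := by
        rw [mul_inv_cancel₀ hρ.ne', one_pow, mul_one, hρρ, hZb, hFF, hF4]
    _ ≤ K * γ * κ ^ 2 * ((1 + 256 * M ^ 2 + 16 * M) * (4 * 16 ^ l) * ρ ^ N *
          Z ^ (1 + (2 / N - 2 / μ)) +
        2 * (16 * 16 ^ l) * ρ ^ N * Z ^ (1 + (2 / N - 2 / μ))) := by
        gcongr
    _ = _ := by ring

/-- The decay rate `q` and the initial threshold `θ` for which `Z_l = θ q ^ l` satisfies the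
recursion `A 16^l Z_l^{1 + ε} ≤ Z_{l+1}`. -/
theorem exists_geometric_decay {A ε : ℝ} (hA : 1 ≤ A) (hε : 0 < ε) :
    ∃ θ q : ℝ, 0 < θ ∧ θ ≤ 1 ∧ 0 < q ∧ q < 1 ∧
      ∀ l : ℕ, A * 16 ^ l * (θ * q ^ l) ^ (1 + ε) ≤ θ * q ^ (l + 1) := by
  set q : ℝ := (1 / 16) ^ (1 / ε) with hq
  have hq0 : 0 < q := by positivity
  have hq1 : q < 1 := Real.rpow_lt_one (by norm_num) (by norm_num) (by positivity)
  have hA0 : 0 < A := by linarith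
  set θ : ℝ := (q / A) ^ (1 / ε) with hθ
  have hθ0 : 0 < θ := by positivity
  have hθ1 : θ ≤ 1 := Real.rpow_le_one (by positivity)
    ((div_le_one hA0).2 (hq1.le.trans hA)) (by positivity)
  refine ⟨θ, q, hθ0, hθ1, hq0, hq1, fun l => ?_⟩
  have e1 : θ ^ ε = q / A := by
    rw [hθ, ← Real.rpow_mul (by positivity), one_div_mul_cancel hε.ne', Real.rpow_one]
  have e2 : (q ^ l) ^ ε = (1 / 16) ^ l := by
    have e0 : q ^ ε = 1 / 16 := by
      rw [hq, ← Real.rpow_mul (by norm_num), one_div_mul_cancel hε.ne', Real.rpow_one]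
    rw [← Real.rpow_natCast, ← Real.rpow_mul hq0.le, mul_comm, Real.rpow_mul hq0.le, e0,
      Real.rpow_natCast]
  rw [Real.rpow_add (by positivity), Real.rpow_one, Real.mul_rpow hθ0.le (by positivity), e1, e2]
  refine le_of_eq ?_
  have e3 : (16 : ℝ) ^ l * (1 / 16) ^ l = 1 := by rw [← mul_pow]; norm_num
  calc A * 16 ^ l * (θ * q ^ l * (q / A * (1 / 16) ^ l))
      = (A / A) * (16 ^ l * (1 / 16) ^ l) * (θ * (q ^ l * q)) := by ring
    _ = _ := by rw [div_self hA0.ne', e3, pow_succ]; ring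

variable {n : ℕ} {Ω : Type*} {mΩ : MeasurableSpace Ω} {P : Measure Ω} {𝓕 : Filtration ℝ≥0 mΩ}
  {t₁ : ℝ}

/-- The De Giorgi iteration: geometric decay of the energies above the levels `κ (1 - 2^{-l})` on
the cylinders of radius `ρ/2 + ρ/2^{l+1}`, provided the initial energy is small relative to `κ`. -/
theorem mNorm_sq_deGiorgi_le [IsFiniteMeasure P] (hn : 1 ≤ n) {C : ℝ≥0}
    (hC : ∀ f : EuclideanSpace ℝ (Fin n) → ℝ, ContDiff ℝ 1 f → HasCompactSupport f →
      ∫⁻ x, ‖f x‖ₑ ^ (2 + 4 / n : ℝ) ≤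
        C * (∫⁻ x, ‖f x‖ₑ ^ (2 : ℝ)) ^ (2 / n : ℝ) * ∫⁻ x, ‖fderiv ℝ f x‖ₑ ^ (2 : ℝ))
    {M : ℝ} (hM0 : 0 < M) (hM : ∀ x, |deriv Real.smoothTransition x| ≤ M)
    {a₀ μ γ A θ q : ℝ} (ha₀ : 0 ≤ a₀) (hμ : (n : ℝ) + 2 < μ) (hγ : 0 ≤ γ)
    (hA : ((C * n ^ 2 : ℝ≥0) : ℝ) ^ (n / (n + 2) : ℝ) * γ *
      (4 * (1 + 256 * M ^ 2 + 16 * M) + 32) ≤ A)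
    (hθ0 : 0 < θ) (hθ1 : θ ≤ 1) (hq0 : 0 < q) (hq1 : q < 1)
    (hdecay : ∀ l : ℕ, A * 16 ^ l * (θ * q ^ l) ^ (1 + (2 / ((n : ℝ) + 2) - 2 / μ)) ≤
      θ * q ^ (l + 1))
    {Q : Set (ℝ × EuclideanSpace ℝ (Fin n))}
    {u : Ω → ℝ → EuclideanSpace ℝ (Fin n) → ℝ} (hineq : LevelSetInequality P 𝓕 Q a₀ μ γ u)
    {x₀ : EuclideanSpace ℝ (Fin n)} {ρ κ : ℝ} (hρ : 0 < ρ) (hρ1 : ρ < 1)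
    (hQ : Ico t₁ (t₁ + ρ ^ 2) ×ˢ Metric.ball x₀ ρ ⊆ Q)
    (hu : AEMeasurable (fun p : Ω × (ℝ × EuclideanSpace ℝ (Fin n)) => u p.1 p.2.1 p.2.2)
      (cylMeasure P univ t₁ (t₁ + ρ ^ 2) (Metric.ball x₀ ρ)))
    (hκ : 0 < κ) (hκa : a₀ * ρ ^ (1 - ((n : ℝ) + 2) / μ) ≤ κ)
    (h0 : mNorm 2 P 𝓕 t₁ (t₁ + ρ ^ 2) (Metric.ball x₀ ρ) (fun ω t x => (u ω t x)⁺) ^ 2 ≤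
      ENNReal.ofReal (κ ^ 2 * ρ ^ ((n : ℝ) + 2) * θ)) (l : ℕ) :
    mNorm 2 P 𝓕 t₁ (t₁ + (ρ / 2 + ρ / 2 ^ (l + 1)) ^ 2)
        (Metric.ball x₀ (ρ / 2 + ρ / 2 ^ (l + 1)))
        (fun ω t x => (u ω t x - κ * (1 - 1 / 2 ^ l))⁺) ^ 2 ≤
      ENNReal.ofReal (κ ^ 2 * ρ ^ ((n : ℝ) + 2) * (θ * q ^ l)) := by
  have hn0 : (1 : ℝ) ≤ n := by exact_mod_cast hn
  have hN0 : (0 : ℝ) < n + 2 := by linarith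
  have hμ0 : 0 < μ := by linarith
  induction l with
  | zero =>
    have e : ρ / 2 + ρ / 2 ^ (0 + 1) = ρ := by ring
    simpa [e] using h0
  | succ l ih =>
    set r' := ρ / 2 + ρ / 2 ^ (l + 1 + 1) with hr'
    set r := ρ / 2 + ρ / 2 ^ (l + 1) with hr
    have hp : (0 : ℝ) < 2 ^ l := by positivity
    have hp1 : (1 : ℝ) ≤ 2 ^ l := one_le_pow₀ (by norm_num)
    have hdiff : r - r' = ρ / 2 ^ (l + 2) := by
      rw [hr, hr']; simp only [pow_succ]; field_simp; ring
    have hdpos : 0 < ρ / 2 ^ (l + 2) := by positivity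
    have hr'0 : ρ / 2 < r' := by rw [hr']; have : 0 < ρ / 2 ^ (l + 1 + 1) := by positivity
                                 linarith
    have hrr' : r' < r := by linarith
    have hrρ : r ≤ ρ := by
      have : ρ / 2 ^ (l + 1) ≤ ρ / 2 := by
        refine div_le_div_of_nonneg_left hρ.le two_pos ?_
        rw [pow_succ]; linarith
      linarith
    have hsq : r' ^ 2 < r ^ 2 := pow_lt_pow_left₀ hrr' (by linarith) two_ne_zero
    have hsqρ : r ^ 2 ≤ ρ ^ 2 := pow_le_pow_left₀ (by linarith) hrρ 2
    have hdiff2 : ρ ^ 2 / 2 ^ (l + 2) ≤ r ^ 2 - r' ^ 2 := by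
      have : r ^ 2 - r' ^ 2 = ρ / 2 ^ (l + 2) * (r + r') := by rw [← hdiff]; ring
      rw [this, show ρ ^ 2 / 2 ^ (l + 2) = ρ / 2 ^ (l + 2) * ρ by ring]
      gcongr
      linarith
    set k := κ * (1 - 1 / 2 ^ (l + 1)) with hk
    set h := κ * (1 - 1 / 2 ^ l) with hh
    have hkh : k - h = κ / 2 ^ (l + 1) := by
      rw [hk, hh]; simp only [pow_succ]; field_simp; ring
    have hk0 : 0 ≤ k := by
      have : 1 / (2 : ℝ) ^ (l + 1) ≤ 1 := by
        rw [div_le_one (by positivity), pow_succ]; linarith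
      exact mul_nonneg hκ.le (by linarith)
    have hkκ : k ≤ κ := by
      have : 0 < 1 / (2 : ℝ) ^ (l + 1) := by positivity
      exact mul_le_of_le_one_right hκ.le (by linarith)
    set Z := θ * q ^ l with hZ
    have hZ0 : 0 ≤ Z := by positivity
    have hZ1 : Z ≤ 1 := mul_le_one₀ hθ1 (by positivity) (pow_le_one₀ hq0.le hq1.le)
    have hstep := deGiorgi_step hn hC hM0 hM (by linarith : 2 < μ) hineq (x₀ := x₀) (h := h)
      (k := k) (r := r') (ρ := r) (s := r' ^ 2) (τ := r ^ 2) (t₁ := t₁)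
      (by have : 0 < κ / 2 ^ (l + 1) := by positivity
          linarith) (by linarith) hrr' (by linarith) (pow_pos (by linarith) 2) hsq
      (hsqρ.trans_lt (pow_lt_one₀ hρ.le hρ1 two_ne_zero))
      ((Set.prod_mono (Ico_subset_Ico_right (by linarith)) (Metric.ball_subset_ball hrρ)).trans hQ)
      (hu.mono_measure (cylMeasure_mono subset_rfl le_rfl (by linarith)
        (Metric.ball_subset_ball hrρ))) ENNReal.ofReal_ne_top ih
    have hY0 : 0 ≤ κ ^ 2 * ρ ^ ((n : ℝ) + 2) * Z := by positivity
    have hδ : 0 < (κ / 2 ^ (l + 1)) ^ 2 := by positivity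
    have hη : 0 ≤ 1 - 2 / μ := by
      have : 2 / μ ≤ 1 := by rw [div_le_one hμ0]; linarith
      linarith
    have hG : ENNReal.ofReal (4 * M / (r ^ 2 - r' ^ 2)) ≤
        ENNReal.ofReal (4 * M / (ρ ^ 2 / 2 ^ (l + 2))) :=
      ENNReal.ofReal_le_ofReal (div_le_div_of_nonneg_left (by positivity) (by positivity) hdiff2)
    rw [hdiff, hkh] at hstep
    refine hstep.trans ?_
    have hreal := deGiorgi_step_arith (N := n + 2)
      (K := ((C * n ^ 2 : ℝ≥0) : ℝ) ^ (n / (n + 2) : ℝ))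
      (by linarith) hμ hκ hρ hρ1 (by positivity) hγ hM0.le ha₀ hκa hZ0 hZ1 l hk0 hkκ
    calc _ ≤ (((C * n ^ 2 : ℝ≥0) : ℝ≥0∞) ^ (n / (n + 2) : ℝ) *
          (ENNReal.ofReal (κ ^ 2 * ρ ^ ((n : ℝ) + 2) * Z) /
            ENNReal.ofReal ((κ / 2 ^ (l + 1)) ^ 2)) ^ (2 / (n + 2) : ℝ)) *
        (ENNReal.ofReal γ * (ENNReal.ofReal (κ ^ 2 * ρ ^ ((n : ℝ) + 2) * Z) *
            (1 + ENNReal.ofReal (4 * M / (ρ / 2 ^ (l + 2))) ^ 2 +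
              ENNReal.ofReal (4 * M / (ρ ^ 2 / 2 ^ (l + 2)))) +
          ENNReal.ofReal (k ^ 2 + a₀ ^ 2) *
            (ENNReal.ofReal (κ ^ 2 * ρ ^ ((n : ℝ) + 2) * Z) /
              ENNReal.ofReal ((κ / 2 ^ (l + 1)) ^ 2)) ^ (1 - 2 / μ))) := by
          exact mul_le_mul_right (mul_le_mul_right (add_le_add (mul_le_mul_right
            (add_le_add le_rfl hG) _) le_rfl) _) _
      _ = ENNReal.ofReal (((C * n ^ 2 : ℝ≥0) : ℝ) ^ (n / (n + 2) : ℝ) *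
          (κ ^ 2 * ρ ^ ((n : ℝ) + 2) * Z / (κ / 2 ^ (l + 1)) ^ 2) ^ (2 / ((n : ℝ) + 2)) *
          (γ * (κ ^ 2 * ρ ^ ((n : ℝ) + 2) * Z * (1 + (4 * M / (ρ / 2 ^ (l + 2))) ^ 2 +
            4 * M / (ρ ^ 2 / 2 ^ (l + 2))) +
          (k ^ 2 + a₀ ^ 2) *
            (κ ^ 2 * ρ ^ ((n : ℝ) + 2) * Z / (κ / 2 ^ (l + 1)) ^ 2) ^ (1 - 2 / μ)))) := by
          rw [← ENNReal.ofReal_coe_nnreal (p := C * n ^ 2), ← ENNReal.ofReal_div_of_pos hδ,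
            ENNReal.ofReal_rpow_of_nonneg (by positivity) (by positivity),
            ENNReal.ofReal_rpow_of_nonneg (by positivity) (by positivity),
            ENNReal.ofReal_rpow_of_nonneg (by positivity) hη,
            ← ENNReal.ofReal_pow (by positivity), ← ENNReal.ofReal_one,
            ← ENNReal.ofReal_add zero_le_one (by positivity),
            ← ENNReal.ofReal_add (by positivity) (by positivity),
            ← ENNReal.ofReal_mul (by positivity), ← ENNReal.ofReal_mul (by positivity),
            ← ENNReal.ofReal_mul (by positivity),
            ← ENNReal.ofReal_add (by positivity) (by positivity),
            ← ENNReal.ofReal_mul hγ, ← ENNReal.ofReal_mul (by positivity)]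
      _ ≤ _ := by
          refine ENNReal.ofReal_le_ofReal (hreal.trans ?_)
          calc _ ≤ A * 16 ^ l * (κ ^ 2 * ρ ^ ((n : ℝ) + 2)) *
                Z ^ (1 + (2 / ((n : ℝ) + 2) - 2 / μ)) := by gcongr
            _ = κ ^ 2 * ρ ^ ((n : ℝ) + 2) *
                (A * 16 ^ l * Z ^ (1 + (2 / ((n : ℝ) + 2) - 2 / μ))) := by ring
            _ ≤ _ := mul_le_mul_of_nonneg_left (hdecay l) (by positivity)

end

/-! ### The local maximum principle -/

section

variable {n : ℕ} {Ω : Type*} {mΩ : MeasurableSpace Ω} {P : Measure Ω} {𝓕 : Filtration ℝ≥0 mΩ}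
  {t₁ t₂ : ℝ} {B : Set (EuclideanSpace ℝ (Fin n))}

theorem predictable_le_prod (𝓕 : Filtration ℝ≥0 mΩ) : 𝓕.predictable ≤ Prod.instMeasurableSpace :=
  measurableSpace_le_predictable_of_measurableSet
    (fun _ hA => (measurableSet_singleton _).prod (𝓕.le _ _ hA))
    (fun _ _ hA => measurableSet_Ioi.prod (𝓕.le _ _ hA))

/-- The predictable σ-algebra is used only through joint measurability in `(ω, t, x)`. -/
theorem IsPredictableField.aemeasurable [SFinite P] {T : ℝ} {D : Set (EuclideanSpace ℝ (Fin n))}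
    {u : Ω → ℝ → EuclideanSpace ℝ (Fin n) → ℝ} (hu : IsPredictableField 𝓕 0 T D u)
    (hB : MeasurableSet B) (hBD : Icc t₁ t₂ ×ˢ B ⊆ Icc 0 T ×ˢ D) :
    AEMeasurable (fun p : Ω × (ℝ × EuclideanSpace ℝ (Fin n)) => u p.1 p.2.1 p.2.2)
      (cylMeasure P univ t₁ t₂ B) := by
  have hU : Measurable (indicator {p : (ℝ≥0 × Ω) × EuclideanSpace ℝ (Fin n) |
      (p.1.1 : ℝ) ∈ Icc 0 T ∧ p.2 ∈ D} (fun p => u p.1.2 (p.1.1 : ℝ) p.2)) :=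
    Measurable.mono hu (sup_le_sup (MeasurableSpace.comap_mono (predictable_le_prod 𝓕)) le_rfl)
      le_rfl
  have hφ : Measurable (fun p : Ω × (ℝ × EuclideanSpace ℝ (Fin n)) =>
      ((p.2.1.toNNReal, p.1), p.2.2)) := by fun_prop
  refine ⟨_, hU.comp hφ, ?_⟩
  rw [cylMeasure, Measure.prod_restrict]
  filter_upwards [ae_restrict_mem (MeasurableSet.univ.prod (measurableSet_Icc.prod hB))] with p hp
  have hp' := hBD hp.2
  have h0 : ((p.2.1.toNNReal : ℝ≥0) : ℝ) = p.2.1 := Real.coe_toNNReal _ hp'.1.1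
  rw [Function.comp_apply, indicator_of_mem]
  · simp only [h0]
  · exact ⟨by simpa only [h0] using hp'.1, hp'.2⟩

theorem Icc_prod_ball_subset {T ρ τ : ℝ} (hτ : 0 < τ) (hρ : 0 < ρ)
    {D : Set (EuclideanSpace ℝ (Fin n))} {x₀ : EuclideanSpace ℝ (Fin n)}
    (h : Ico t₁ (t₁ + τ) ×ˢ Metric.ball x₀ ρ ⊆ Icc 0 T ×ˢ D) :
    Icc t₁ (t₁ + τ) ×ˢ Metric.ball x₀ ρ ⊆ Icc 0 T ×ˢ D := by
  have ht : Ico t₁ (t₁ + τ) ⊆ Icc 0 T := fun t ht =>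
    (h (mk_mem_prod ht (Metric.mem_ball_self hρ))).1
  have hx : Metric.ball x₀ ρ ⊆ D := fun x hx =>
    (h (mk_mem_prod (left_mem_Ico.2 (by linarith)) hx)).2
  refine Set.prod_mono ?_ hx
  rw [← closure_Ico (by linarith : t₁ ≠ t₁ + τ)]
  exact closure_minimal ht isClosed_Icc

theorem essSupField_posPart_le_of_mNorm_eq_zero [IsFiniteMeasure P] (ht : t₁ ≤ t₂)
    {u : Ω → ℝ → EuclideanSpace ℝ (Fin n) → ℝ}
    (hu : AEMeasurable (fun p : Ω × (ℝ × EuclideanSpace ℝ (Fin n)) => u p.1 p.2.1 p.2.2)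
      (cylMeasure P univ t₁ t₂ B)) {κ : ℝ} (hκ : 0 ≤ κ)
    (h : mNorm 2 P 𝓕 t₁ t₂ B (fun ω t x => (u ω t x - κ)⁺) ^ 2 ≤ 0) :
    essSupField P t₁ t₂ B (fun ω t x => (u ω t x)⁺) ≤ ENNReal.ofReal κ := by
  have hm : AEMeasurable (fun p : Ω × (ℝ × EuclideanSpace ℝ (Fin n)) =>
      (u p.1 p.2.1 p.2.2 - κ)⁺) (cylMeasure P univ t₁ t₂ B) := (hu.sub_const κ).sup_const 0
  have h1 := (mNorm_sq_le_iff (𝓕 := 𝓕) (w := fun ω t x => (u ω t x - κ)⁺) hm).1 h t₁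
    (left_mem_Icc.2 ht) univ MeasurableSet.univ
  rw [zero_mul, nonpos_iff_eq_zero, lintegral_eq_zero_iff' (hm.enorm.pow_const _)] at h1
  have hle : P.prod (volume.restrict (Ico t₁ t₂ ×ˢ B)) ≤ cylMeasure P univ t₁ t₂ B := by
    rw [cylMeasure, Measure.restrict_univ]
    exact Measure.prod_mono le_rfl (Measure.restrict_mono
      (Set.prod_mono Ico_subset_Icc_self subset_rfl) le_rfl)
  refine essSup_le_of_ae_le _ ((ae_mono hle) ?_)
  filter_upwards [h1] with p hp
  have h2 : (u p.1 p.2.1 p.2.2 - κ)⁺ = 0 := by simpa using hp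
  have h3 : u p.1 p.2.1 p.2.2 - κ ≤ 0 := posPart_eq_zero.1 h2
  exact ENNReal.ofReal_le_ofReal (sup_le (by linarith) hκ)

/-- The local maximum principle for the positive part, from the inequality of the De Giorgi class
alone. -/
theorem exists_essSupField_posPart_le (hn : 1 ≤ n) {a₀ μ γ : ℝ} (ha₀ : 0 ≤ a₀)
    (hμ : (n : ℝ) + 2 < μ) (hγ : 0 ≤ γ) :
    ∃ C : ℝ, 0 < C ∧ ∀ (Ω : Type*) (mΩ : MeasurableSpace Ω) (P : Measure Ω)
      (_ : IsFiniteMeasure P) (𝓕 : Filtration ℝ≥0 mΩ) (Q : Set (ℝ × EuclideanSpace ℝ (Fin n)))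
      (u : Ω → ℝ → EuclideanSpace ℝ (Fin n) → ℝ) (t₁ ρ : ℝ) (x₀ : EuclideanSpace ℝ (Fin n)),
      LevelSetInequality P 𝓕 Q a₀ μ γ u → ρ ∈ Ioo (0 : ℝ) 1 →
      Ico t₁ (t₁ + ρ ^ 2) ×ˢ Metric.ball x₀ ρ ⊆ Q →
      AEMeasurable (fun p : Ω × (ℝ × EuclideanSpace ℝ (Fin n)) => u p.1 p.2.1 p.2.2)
        (cylMeasure P univ t₁ (t₁ + ρ ^ 2) (Metric.ball x₀ ρ)) →
      essSupField P t₁ (t₁ + (ρ / 2) ^ 2) (Metric.ball x₀ (ρ / 2)) (fun ω t x => (u ω t x)⁺) ≤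
        ENNReal.ofReal C * (ENNReal.ofReal (ρ ^ (-((n : ℝ) + 2) / 2)) *
          mNorm 2 P 𝓕 t₁ (t₁ + ρ ^ 2) (Metric.ball x₀ ρ) (fun ω t x => (u ω t x)⁺) +
            ENNReal.ofReal (a₀ * ρ ^ (1 - ((n : ℝ) + 2) / μ))) := by
  obtain ⟨K, hK⟩ := exists_gagliardo_nirenberg hn
  obtain ⟨M, hM0, hM⟩ := exists_abs_deriv_smoothTransition_le
  set A := max 1 (((K * n ^ 2 : ℝ≥0) : ℝ) ^ (n / (n + 2) : ℝ) * γ *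
      (4 * (1 + 256 * M ^ 2 + 16 * M) + 32)) with hA
  have hN0 : (0 : ℝ) < n + 2 := by positivity
  obtain ⟨θ, q, hθ0, hθ1, hq0, hq1, hdecay⟩ := exists_geometric_decay (le_max_left 1 _ : 1 ≤ A)
    (sub_pos.2 (div_lt_div_of_pos_left two_pos hN0 hμ))
  set C := θ ^ (-(1 / 2) : ℝ) with hC
  have hC0 : 0 < C := Real.rpow_pos_of_pos hθ0 _
  have hC1 : 1 ≤ C := Real.one_le_rpow_of_pos_of_le_one_of_nonpos hθ0 hθ1 (by norm_num)
  have hCθ : C ^ 2 * θ = 1 := by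
    rw [hC, ← Real.rpow_natCast, ← Real.rpow_mul hθ0.le, ← Real.rpow_add_one hθ0.ne']
    norm_num
  refine ⟨C, hC0, fun Ω mΩ P _ 𝓕 Q u t₁ ρ x₀ hineq ⟨hρ, hρ1⟩ hQ hu => ?_⟩
  set Y := mNorm 2 P 𝓕 t₁ (t₁ + ρ ^ 2) (Metric.ball x₀ ρ) (fun ω t x => (u ω t x)⁺) with hY
  set b := ρ ^ (-((n : ℝ) + 2) / 2) with hb
  have hb0 : 0 < b := Real.rpow_pos_of_pos hρ _
  have hbρ : b ^ 2 * ρ ^ ((n : ℝ) + 2) = 1 := by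
    rw [hb, ← Real.rpow_natCast, ← Real.rpow_mul hρ.le, ← Real.rpow_add hρ]
    convert Real.rpow_zero ρ using 2
    push_cast; ring
  rcases eq_or_ne Y ∞ with hYtop | hYtop
  · rw [hYtop, ENNReal.mul_top (ENNReal.ofReal_pos.2 hb0).ne', top_add,
      ENNReal.mul_top (ENNReal.ofReal_pos.2 hC0).ne']
    exact le_top
  set κ₀ := C * (b * Y.toReal + a₀ * ρ ^ (1 - ((n : ℝ) + 2) / μ)) with hκ₀
  have hα : 0 ≤ a₀ * ρ ^ (1 - ((n : ℝ) + 2) / μ) := by positivity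
  have hY0 : 0 ≤ Y.toReal := ENNReal.toReal_nonneg
  have hrhs : ENNReal.ofReal C * (ENNReal.ofReal b * Y +
      ENNReal.ofReal (a₀ * ρ ^ (1 - ((n : ℝ) + 2) / μ))) = ENNReal.ofReal κ₀ := by
    rw [hκ₀, ENNReal.ofReal_mul hC0.le, ENNReal.ofReal_add (by positivity) hα,
      ENNReal.ofReal_mul hb0.le, ENNReal.ofReal_toReal hYtop]
  rw [hrhs]
  refine ENNReal.le_of_forall_pos_le_add fun δ hδ _ => ?_
  have hδ' : (0 : ℝ) < δ := hδ
  have hκ₀0 : 0 ≤ κ₀ := by positivity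
  rw [← ENNReal.ofReal_coe_nnreal, ← ENNReal.ofReal_add hκ₀0 hδ'.le]
  -- the levels have to increase strictly, so `κ` must be positive even if `κ₀ = 0`
  set κ := κ₀ + δ with hκ
  have hκ0 : 0 < κ := by linarith
  have hκa : a₀ * ρ ^ (1 - ((n : ℝ) + 2) / μ) ≤ κ := by
    have h1 : a₀ * ρ ^ (1 - ((n : ℝ) + 2) / μ) ≤ κ₀ := by
      have : 0 ≤ b * Y.toReal := by positivity
      exact (le_add_of_nonneg_left this).trans (le_mul_of_one_le_left (by positivity) hC1)
    linarith
  have h0 : Y ^ 2 ≤ ENNReal.ofReal (κ ^ 2 * ρ ^ ((n : ℝ) + 2) * θ) := by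
    rw [← ENNReal.ofReal_toReal hYtop, ← ENNReal.ofReal_pow hY0]
    refine ENNReal.ofReal_le_ofReal ?_
    have h1 : C * b * Y.toReal ≤ κ := by
      have : 0 ≤ C * (a₀ * ρ ^ (1 - ((n : ℝ) + 2) / μ)) := by positivity
      rw [hκ, hκ₀]; linarith
    calc Y.toReal ^ 2 = (C * b * Y.toReal) ^ 2 * ρ ^ ((n : ℝ) + 2) * θ := by
          linear_combination (-Y.toReal ^ 2 * (C ^ 2 * θ)) * hbρ - Y.toReal ^ 2 * hCθ
      _ ≤ _ := by gcongr
  have hiter := mNorm_sq_deGiorgi_le hn hK hM0 hM ha₀ hμ hγ (le_max_right _ _) hθ0 hθ1 hq0 hq1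
    hdecay hineq hρ hρ1 hQ hu hκ0 hκa h0
  have hsmall : t₁ + (ρ / 2) ^ 2 ≤ t₁ + ρ ^ 2 := by
    have := pow_le_pow_left₀ (by positivity) (by linarith : ρ / 2 ≤ ρ) 2
    linarith
  refine essSupField_posPart_le_of_mNorm_eq_zero (𝓕 := 𝓕)
    (le_add_of_nonneg_right (by positivity))
    (hu.mono_measure (cylMeasure_mono subset_rfl le_rfl hsmall
      (Metric.ball_subset_ball (by linarith)))) hκ0.le ?_
  have hlim : Tendsto (fun l : ℕ => ENNReal.ofReal (κ ^ 2 * ρ ^ ((n : ℝ) + 2) * (θ * q ^ l)))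
      atTop (𝓝 0) := by
    rw [← ENNReal.ofReal_zero]
    refine (ENNReal.continuous_ofReal.tendsto 0).comp ?_
    have := ((tendsto_pow_atTop_nhds_zero_of_lt_one hq0.le hq1).const_mul θ).const_mul
      (κ ^ 2 * ρ ^ ((n : ℝ) + 2))
    simpa using this
  refine ge_of_tendsto' hlim fun l => le_trans ?_ (hiter l)
  have hrad : ρ / 2 ≤ ρ / 2 + ρ / 2 ^ (l + 1) := le_add_of_nonneg_right (by positivity)
  refine mNorm_sq_mono (add_le_add_right (pow_le_pow_left₀ (by positivity) hrad 2) _)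
    Metric.isOpen_ball.measurableSet (Metric.ball_subset_ball hrad) fun ω t _ x _ => ?_
  rw [← ofReal_norm, ← ofReal_norm, Real.norm_of_nonneg (posPart_nonneg _),
    Real.norm_of_nonneg (posPart_nonneg _)]
  refine ENNReal.ofReal_le_ofReal (posPart_mono ?_)
  have : 0 ≤ κ * (1 / 2 ^ l) := by positivity
  linarith

end

end BSPDG

end

theorem theorem5p8 (n : ℕ) (hn : 1 ≤ n) (a₀ μ γ : ℝ) (ha₀ : 0 ≤ a₀) (hμ : (n : ℝ) + 2 < μ)
    (hγ : 0 ≤ γ) :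
    ∃ C : ℝ, 0 < C ∧
      ∀ (Ω : Type*) (mΩ : MeasurableSpace Ω) (P : Measure Ω) (_ : IsProbabilityMeasure P)
        (_ : P.IsComplete) (m : ℕ) (W : Fin m → ℝ≥0 → Ω → ℝ) (𝓕 : Filtration ℝ≥0 mΩ)
        (_ : BSPDG.IsBrownianSetup P W 𝓕)
        (T : ℝ) (_ : 0 < T) (D : Set (EuclideanSpace ℝ (Fin n))) (_ : IsOpen D)
        (u : Ω → ℝ → EuclideanSpace ℝ (Fin n) → ℝ)
        (t₀ ρ : ℝ) (x₀ : EuclideanSpace ℝ (Fin n)),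
        ρ ∈ Ioo (0 : ℝ) 1 →
        Ico t₀ (t₀ + ρ ^ 2) ×ˢ Metric.ball x₀ ρ ⊆ Icc 0 T ×ˢ D →
        (BSPDG.IsBSPDGPlus P 𝓕 T D a₀ μ γ u →
          BSPDG.essSupField P t₀ (t₀ + (ρ / 2) ^ 2) (Metric.ball x₀ (ρ / 2))
              (fun ω t x => (u ω t x)⁺) ≤
            ENNReal.ofReal C *
              (ENNReal.ofReal (ρ ^ (-((n : ℝ) + 2) / 2)) *
                  BSPDG.mNorm 2 P 𝓕 t₀ (t₀ + ρ ^ 2) (Metric.ball x₀ ρ)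
                    (fun ω t x => (u ω t x)⁺) +
                ENNReal.ofReal (a₀ * ρ ^ (1 - ((n : ℝ) + 2) / μ)))) ∧
        (BSPDG.IsBSPDGMinus P 𝓕 T D a₀ μ γ u →
          BSPDG.essSupField P t₀ (t₀ + (ρ / 2) ^ 2) (Metric.ball x₀ (ρ / 2))
              (fun ω t x => (u ω t x)⁻) ≤
            ENNReal.ofReal C *
              (ENNReal.ofReal (ρ ^ (-((n : ℝ) + 2) / 2)) *
                  BSPDG.mNorm 2 P 𝓕 t₀ (t₀ + ρ ^ 2) (Metric.ball x₀ ρ)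
                    (fun ω t x => (u ω t x)⁻) +
                ENNReal.ofReal (a₀ * ρ ^ (1 - ((n : ℝ) + 2) / μ)))) := by
  obtain ⟨C, hC0, hC⟩ := BSPDG.exists_essSupField_posPart_le hn ha₀ hμ hγ
  refine ⟨C, hC0, fun Ω mΩ P _ _ m W 𝓕 _ T _ D _ u t₀ ρ x₀ hρ hQ => ?_⟩
  have hQ' := BSPDG.Icc_prod_ball_subset (pow_pos hρ.1 2) hρ.1 hQ
  refine ⟨fun hu => ?_, fun hu => ?_⟩
  · exact hC Ω mΩ P inferInstance 𝓕 _ u t₀ ρ x₀ hu.levelSetInequality hρ hQ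
      (hu.memV20.predictable.aemeasurable Metric.isOpen_ball.measurableSet hQ')
  · have h := hC Ω mΩ P inferInstance 𝓕 _ (fun ω t x => -u ω t x) t₀ ρ x₀
      hu.levelSetInequality_neg hρ hQ
      (hu.memV20.predictable.aemeasurable Metric.isOpen_ball.measurableSet hQ').neg
    simpa only [posPart_neg] using h
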